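/- A *radial system* $R$ on a finite set $V$ assigns to every $i\in V$ a cyclic ordering $R(i)$ of $V\setminus\{i\}$; a subset $S\subseteq V$ *induces* the radial system on $S$ obtained by restricting each $R(i)$, $i\in S$, to $S\setminus\{i\}$. A *generalized configuration of points* consists of distinct labeled points in the plane together with an arrangement of pseudo-lines (bi-infinite $x$-monotone curves, any two of which meet in exactly one point and cross there), such that each pair of points lies on a pseudo-line and each pseudo-line contains exactly two of the points. $R$ is *realizable as an abstract order type* if there is a generalized configuration of points $(p_i)_{i\in V}$ such that, for every $i$, $R(i)$ is the counterclockwise order of the other points around $p_i$; equivalently, in terms of the orientations $\chi$ of its triples, $j,l,m$ occur in this cyclic order in $R(i)$ iff at least two of the triples $(i,j,l)$, $(i,l,m)$, $(i,m,j)$ are oriented counterclockwise. $R$ is *realizable as a point set order type* if the same holds for a labeled set of points in the plane, no three collinear, with straight lines. **Theorem.** For every $k\ge 3$ there is a radial system $R_k$ on the $2k+1$ elements $v_1,\dots,v_k,w_1,\dots,w_k,u$ with the following properties (indices modulo $k$). 1. $R_k$ is built from a double circle and an additional vertex $u$: for all sufficiently small $\varepsilon>0$, the radial system induced on $\{v_1,\dots,v_k,w_1,\dots,w_k\}$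 is the radial system of the point set in general position that consists of the vertices $v_1,\dots,v_k$ of a regular $k$-gon centered at the origin, in counterclockwise order, and the points $w_i=(1-\varepsilon)\frac{v_i+v_{i+1}}2$; the element $u$ comes directly between $v_{i-1}$ and $v_{i+1}$ in $R_k(v_i)$ (that is, $v_{i-1},u,v_{i+1}$ are consecutive), and directly between $v_i$ and $v_{i+1}$ in $R_k(w_i)$ (that is, $v_i,u,v_{i+1}$ are consecutive). 2. $R_k$ is not realizable as an abstract order type. 3. For every proper subset of the elements (in particular, after the removal of any single element), the induced radial system is realizable as a point set order type. Consequently, realizability cannot be tested on subsets of bounded size: there is no $m\in\mathbb N$ such that every radial system on a finite set, all of whose induced radial systems on at most $m$ elements are realizable as abstract order types, is itself realizable as an abstract order type. -/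

import Mathlib

open Filter Topology

/-! ### Radial systems -/

/-- Pullback of a circular order along an injective map. -/
abbrev circularOrderComap {α β : Type*} (o : CircularOrder α) (f : β → α)
    (hf : Function.Injective f) : CircularOrder β where
  btw a b c := btw (f a) (f b) (f c)
  sbtw a b c := sbtw (f a) (f b) (f c)
  btw_refl a := btw_refl (f a)
  btw_cyclic_left h := btw_cyclic_left h
  sbtw_iff_btw_not_btw := sbtw_iff_btw_not_btw
  sbtw_trans_left h h' := sbtw_trans_left h h'
  btw_antisymm h h' := by
    rcases btw_antisymm h h' with h | h | h
    · exact Or.inl (hf h)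
    · exact Or.inr (Or.inl (hf h))
    · exact Or.inr (Or.inr (hf h))
  btw_total a b c := btw_total (f a) (f b) (f c)

/-- A (candidate) radial system on the label set `V`: for every label `i`, a cyclic ordering of the
labels different from `i`, to be thought of as their counterclockwise order around `i`. -/
structure RadialSystem (V : Type*) where
  order : ∀ i : V, CircularOrder {j : V // j ≠ i}

namespace RadialSystem

variable {V W : Type*}

/-- In the cyclic ordering around `i`, the three distinct labels `j`, `l`, `m` (all different
from `i`) occur in the cyclic order `j`, `l`, `m`. -/
def Ccw (R : RadialSystem V) (i j l m : V) : Prop :=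
  ∃ (hj : j ≠ i) (hl : l ≠ i) (hm : m ≠ i),
    (R.order i).toSBtw.sbtw ⟨j, hj⟩ ⟨l, hl⟩ ⟨m, hm⟩

/-- Going around `i` in the positive direction from `a` to `b`, the label `x` is met, and
no other label is. -/
def DirectlyBetween (R : RadialSystem V) (i a x b : V) : Prop :=
  R.Ccw i a x b ∧ ∀ y, R.Ccw i a y b → y = x

/-- The radial system induced on `W` by an injective relabelling `f : W ↪ V`. -/
def comap (R : RadialSystem V) (f : W ↪ V) : RadialSystem W where
  order i := circularOrderComap (R.order (f i))
    (fun j : {j : W // j ≠ i} => ⟨f j.1, fun h => j.2 (f.injective h)⟩)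
    (fun _ _ h => Subtype.ext (f.injective (congrArg Subtype.val h)))

/-- The radial system induced by a subset of the labels. -/
def induce (R : RadialSystem V) (S : Set V) : RadialSystem S :=
  R.comap (Function.Embedding.subtype (· ∈ S))

end RadialSystem

/-! ### Chirotopes of point sets and of generalized configurations -/

/-- The chirotope of a labeled planar point set: `1` for counterclockwise triples,
`-1` for clockwise triples, `0` for collinear triples. -/
noncomputable def pointChirotope {V : Type*} (p : V → ℝ × ℝ) (a b c : V) : SignType :=
  SignType.sign (((p b).1 - (p a).1) * ((p c).2 - (p a).2)
    - ((p b).2 - (p a).2) * ((p c).1 - (p a).1))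

/-- Labeled points that are pairwise distinct, no three of them on a line. -/
def GeneralPosition {V : Type*} (p : V → ℝ × ℝ) : Prop :=
  Function.Injective p ∧
    ∀ a b c : V, a ≠ b → b ≠ c → a ≠ c → pointChirotope p a b c ≠ 0

/-- The graphs of `f` and `g` have exactly one common point, and they cross there. -/
def CrossOnce (f g : ℝ → ℝ) : Prop :=
  ∃ x₀, f x₀ = g x₀ ∧
    (((∀ x < x₀, f x < g x) ∧ ∀ x > x₀, g x < f x) ∨
      ((∀ x < x₀, g x < f x) ∧ ∀ x > x₀, f x < g x))

/-- A generalized configuration of points: labeled points in the plane together with an arrangement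
of pseudo-lines (bi-infinite `x`-monotone curves, i.e. graphs of continuous functions), one for each
pair of distinct labels, such that every pseudo-line contains exactly the two points of its pair,
and any two pseudo-lines have exactly one common point, at which they cross. The value of `line`
on the degenerate pairs `s(a, a)` is irrelevant. -/
structure GeneralizedConfiguration (V : Type*) where
  pt : V → ℝ × ℝ
  pt_injective : Function.Injective pt
  line : Sym2 V → ℝ → ℝ
  continuous_line : ∀ e, ¬ e.IsDiag → Continuous (line e)
  mem_line_iff : ∀ e, ¬ e.IsDiag → ∀ c, (pt c).2 = line e (pt c).1 ↔ c ∈ e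
  crossOnce : ∀ e f, ¬ e.IsDiag → ¬ f.IsDiag → e ≠ f → CrossOnce (line e) (line f)

/-- The chirotope of a generalized configuration. For distinct `a`, `b`, `c` it is `1` if `c` is to
the left of the pseudo-line through `a` and `b`, directed from `a` to `b` (above it if `a` is
horizontally before `b`, below it if `a` is horizontally after `b`), and `-1` otherwise. It is `0`
if two of the labels coincide. -/
noncomputable def GeneralizedConfiguration.chirotope {V : Type*} (Q : GeneralizedConfiguration V)
    (a b c : V) : SignType :=
  SignType.sign (((Q.pt b).1 - (Q.pt a).1) * ((Q.pt c).2 - Q.line s(a, b) (Q.pt c).1))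

/-! ### The radial system of a chirotope and realizability -/

/-- Around `i`, the labels `j`, `l`, `m` occur in this counterclockwise order. Of the three
angular gaps, from `j` to `l`, from `l` to `m` and from `m` to `j`, at most one exceeds a half-turn
if the order is counterclockwise, and at least two do if it is clockwise; a gap is less than a
half-turn precisely if the corresponding triple is oriented counterclockwise. -/
def CcwAround {V : Type*} (χ : V → V → V → SignType) (i j l m : V) : Prop :=
  (χ i j l = 1 ∧ χ i l m = 1) ∨ (χ i l m = 1 ∧ χ i m j = 1) ∨ (χ i m j = 1 ∧ χ i j l = 1)

namespace RadialSystem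

variable {V : Type*}

/-- `R` is the counterclockwise radial system of the chirotope `χ`. -/
def IsRadialSystemOf (R : RadialSystem V) (χ : V → V → V → SignType) : Prop :=
  ∀ i j l m : V, j ≠ i → l ≠ i → m ≠ i → j ≠ l → l ≠ m → j ≠ m →
    (R.Ccw i j l m ↔ CcwAround χ i j l m)

/-- `R` is the radial system of the labeled point set `p`, which is in general position. -/
def IsRealizedByPoints (R : RadialSystem V) (p : V → ℝ × ℝ) : Prop :=
  GeneralPosition p ∧ R.IsRadialSystemOf (pointChirotope p)

/-- `R` is realizable as a point set order type. -/
def RealizableAsPointSet (R : RadialSystem V) : Prop :=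
  ∃ p : V → ℝ × ℝ, R.IsRealizedByPoints p

/-- `R` is realizable as an abstract order type. -/
def RealizableAsAbstractOrderType (R : RadialSystem V) : Prop :=
  ∃ Q : GeneralizedConfiguration V, R.IsRadialSystemOf Q.chirotope

end RadialSystem

/-! ### The double circle with an additional vertex -/

/-- The vertex with index `i` (modulo `k`) of a regular `k`-gon, in counterclockwise order. -/
noncomputable def polygonVertex (k i : ℕ) : ℝ × ℝ :=
  (Real.cos (2 * Real.pi * i / k), Real.sin (2 * Real.pi * i / k))

/-- The points of the double circle: the vertices `v i` of a regular `k`-gon (left summand), and for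
each `i` the point `w i` (right summand) obtained by moving the midpoint of the edge from `v i` to
`v (i + 1)` towards the center by the factor `1 - ε`. -/
noncomputable def doubleCircle (k : ℕ) (ε : ℝ) : Fin k ⊕ Fin k → ℝ × ℝ
  | Sum.inl i => polygonVertex k i
  | Sum.inr i => (1 - ε) • midpoint ℝ (polygonVertex k i) (polygonVertex k (i + 1))

/-- The labels `v i`, `w i` of the double circle and one additional label `u`. -/
abbrev DCVertex (k : ℕ) : Type := Option (Fin k ⊕ Fin k)

namespace DCVertex

variable {k : ℕ}

abbrev v (i : Fin k) : DCVertex k := some (Sum.inl i)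

abbrev w (i : Fin k) : DCVertex k := some (Sum.inr i)

abbrev u : DCVertex k := none

end DCVertex

open DCVertex in
/-- `R` is built from a double circle and one additional vertex `u`: without `u` it is the radial
system of the double circle whose inner points are arbitrarily close to the midpoints of the edges;
`u` comes directly between `v (i - 1)` and `v (i + 1)` around `v i`, and directly between `v i` and
`v (i + 1)` around `w i`, indices modulo `k`. -/
def IsDoubleCirclePlusVertex {k : ℕ} (R : RadialSystem (DCVertex k)) : Prop :=
  (∀ᶠ ε in 𝓝[>] (0 : ℝ),
    (R.comap Function.Embedding.some).IsRealizedByPoints (doubleCircle k ε)) ∧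
  (∀ i : Fin k, R.DirectlyBetween (v i) (v ((finRotate k).symm i)) u (v (finRotate k i))) ∧
  (∀ i : Fin k, R.DirectlyBetween (w i) (v i) u (v (finRotate k i)))

/-!
Around `v i`, `u` and `w i` the prescribed cyclic orders force `v i`, `u`, `v (i + 1)`, `w i` to
be a convex quadrilateral, so `u` lies beyond every edge of the polygon and beyond both sides of
every dent. Walk along the boundary of the double circle from `v 1` to `v (k - 1)`: the label `u`
stays to the right of the rays from `v 0` to the points on the way, since otherwise it would be to
the left of all three sides of a clockwise triangle, which no interior triple system allows. But
then `u` is to the right of the ray from `v 0` to `v (k - 1)`, although it lies beyond the edge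
from `v (k - 1)` to `v 0`. Chirotopes of generalized configurations are interior triple systems,
because the leftmost of four points is never surrounded by the others.

As `ε → 0`, the points of the double circle become vertices and midpoints of edges, so the
determinant of three of them is the mean of determinants of triples of polygon vertices, all
nonnegative, and not all zero unless the three points are `v i`, `w i` and `v (i + 1)`.

Without `w r` or `v r`, the boundary of the double circle can be opened into a chain along a
parabola, every second point of it a dent, and `u` put far below the chain. Finally, moving the
points of a finite set in general position by small multiples of the points `(2 ^ n, 4 ^ n)` makes
their connecting lines an arrangement of pseudo-lines, so point set order types are abstract.
-/

/-! ### Triple systems -/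

/-- Knuth's interior triple systems (*Axioms and Hulls*): alternating sign functions of triples,
nonzero on distinct labels, such that a triangle with a point to the left of its three directed
sides is counterclockwise. Triples with a repeated label are not excluded from the symmetry axioms,
which give them the value `0`. -/
structure IsInteriorTripleSystem {V : Type*} (χ : V → V → V → SignType) : Prop where
  swap_left : ∀ a b c, χ b a c = -χ a b c
  rotate : ∀ a b c, χ b c a = χ a b c
  ne_zero : ∀ a b c, a ≠ b → b ≠ c → a ≠ c → χ a b c ≠ 0
  interior : ∀ t a b c, χ t a b = 1 → χ t b c = 1 → χ t c a = 1 → χ a b c = 1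

namespace IsInteriorTripleSystem

variable {V : Type*} {χ : V → V → V → SignType}

theorem ne_of_eq_one (hχ : IsInteriorTripleSystem χ) {a b c : V} (h : χ a b c = 1) :
    a ≠ b ∧ b ≠ c ∧ a ≠ c := by
  have eq_zero : ∀ x y : V, χ x x y = 0 := fun x y => by
    have hxx := hχ.swap_left x x y
    generalize χ x x y = s at hxx ⊢
    decide +revert
  refine ⟨?_, ?_, ?_⟩ <;> rintro rfl
  · exact absurd (h.symm.trans (eq_zero a c)) one_ne_zero
  · exact absurd (h.symm.trans ((hχ.rotate a b b).symm.trans (eq_zero b a))) one_ne_zero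
  · exact absurd (h.symm.trans ((hχ.rotate a a b).trans (eq_zero a b))) one_ne_zero

theorem eq_one_or_swap_eq_one (hχ : IsInteriorTripleSystem χ) {a b c : V} (hab : a ≠ b)
    (hbc : b ≠ c) (hac : a ≠ c) : χ a b c = 1 ∨ χ b a c = 1 := by
  have hne := hχ.ne_zero a b c hab hbc hac
  rw [hχ.swap_left a b c]
  generalize χ a b c = s at hne ⊢
  decide +revert

theorem eq_one_of_convex (hχ : IsInteriorTripleSystem χ) {a b c d : V}
    (ha : CcwAround χ a b c d) (hb : CcwAround χ b c d a) (hc : CcwAround χ c d a b) :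
    χ a b c = 1 ∧ χ a b d = 1 ∧ χ a c d = 1 ∧ χ b c d = 1 := by
  have hadb : χ a d b = -χ a b d := (hχ.rotate b a d).trans (hχ.swap_left a b d)
  rw [CcwAround, hadb] at ha
  rw [CcwAround, hχ.rotate a b d, hχ.swap_left a b c] at hb
  rw [CcwAround, hχ.rotate a c d, ← hχ.rotate c a b, hχ.swap_left b c d] at hc
  generalize χ a b c = s₁, χ a b d = s₂, χ a c d = s₃, χ b c d = s₄ at ha hb hc ⊢
  decide +revert

/-- If `u` were to the left of the ray from `o` to the next point `p (t + 1)` of the fan, it would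
be to the left of the three sides of the clockwise triangle `p t`, `o`, `p (t + 1)`. -/
theorem beyond_fan (hχ : IsInteriorTripleSystem χ) {o u : V} {p : ℕ → V} {m n : ℕ} (hmn : m ≤ n)
    (hbase : χ o u (p m) = 1) (hfan : ∀ t, m ≤ t → t < n → χ o (p t) (p (t + 1)) = 1)
    (hedge : ∀ t, m ≤ t → t < n → χ (p t) u (p (t + 1)) = 1) : χ o u (p n) = 1 := by
  induction n, hmn using Nat.le_induction with
  | base => exact hbase
  | succ t hmt ih =>
    have hou := ih (fun s hs hst => hfan s hs (by omega)) fun s hs hst => hedge s hs (by omega)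
    have hop := hfan t hmt t.lt_succ_self
    have hpu := hedge t hmt t.lt_succ_self
    obtain ⟨hne_ou, -, -⟩ := hχ.ne_of_eq_one hou
    obtain ⟨-, -, hne_op⟩ := hχ.ne_of_eq_one hop
    obtain ⟨-, hne_up, -⟩ := hχ.ne_of_eq_one hpu
    refine (hχ.eq_one_or_swap_eq_one hne_ou hne_up hne_op).resolve_right fun huo => ?_
    have hclockwise : χ (p t) o (p (t + 1)) = 1 :=
      hχ.interior u _ _ _ (by rwa [hχ.rotate]) huo (by rwa [hχ.rotate])
    rw [hχ.swap_left, hop] at hclockwise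
    exact absurd hclockwise (by decide)

end IsInteriorTripleSystem

theorem CrossOnce.exists_sign_sub_eq {f g : ℝ → ℝ} (h : CrossOnce f g) {x₀ : ℝ}
    (h₀ : f x₀ = g x₀) :
    ∃ σ : SignType, ∀ x, SignType.sign (f x - g x) = σ * SignType.sign (x - x₀) := by
  obtain ⟨z, -, ⟨hl, hr⟩ | ⟨hl, hr⟩⟩ := h
  · obtain rfl : x₀ = z := by
      rcases lt_trichotomy x₀ z with h | h | h
      exacts [absurd h₀ (hl _ h).ne, h, absurd h₀ (hr _ h).ne']
    refine ⟨1, fun x => ?_⟩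
    rcases lt_trichotomy x x₀ with h | rfl | h
    · rw [sign_neg (sub_neg.2 (hl x h)), sign_neg (sub_neg.2 h), one_mul]
    · rw [h₀, sub_self, sub_self, one_mul]
    · rw [sign_pos (sub_pos.2 (hr x h)), sign_pos (sub_pos.2 h), one_mul]
  · obtain rfl : x₀ = z := by
      rcases lt_trichotomy x₀ z with h | h | h
      exacts [absurd h₀ (hl _ h).ne', h, absurd h₀ (hr _ h).ne]
    refine ⟨-1, fun x => ?_⟩
    rcases lt_trichotomy x x₀ with h | rfl | h
    · rw [sign_pos (sub_pos.2 (hl x h)), sign_neg (sub_neg.2 h)]; rfl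
    · rw [h₀, sub_self, sub_self, sign_zero, mul_zero]
    · rw [sign_neg (sub_neg.2 (hr x h)), sign_pos (sub_pos.2 h), mul_one]

namespace GeneralizedConfiguration

variable {V : Type*} (Q : GeneralizedConfiguration V) {a b c d : V}

theorem line_left (h : a ≠ b) : Q.line s(a, b) (Q.pt a).1 = (Q.pt a).2 :=
  ((Q.mem_line_iff s(a, b) (by simpa using h) a).2 (Sym2.mem_mk_left a b)).symm

theorem line_right (h : a ≠ b) : Q.line s(a, b) (Q.pt b).1 = (Q.pt b).2 :=
  ((Q.mem_line_iff s(a, b) (by simpa using h) b).2 (Sym2.mem_mk_right a b)).symm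

theorem fst_ne (h : a ≠ b) : (Q.pt a).1 ≠ (Q.pt b).1 := fun hx =>
  h (Q.pt_injective (Prod.ext hx (by rw [← Q.line_left h, ← Q.line_right h, hx])))

theorem chirotope_self_left (a c : V) : Q.chirotope a a c = 0 := by
  rw [chirotope, sub_self, zero_mul, sign_zero]

theorem chirotope_self_right (a b : V) : Q.chirotope a b b = 0 := by
  obtain rfl | hab := eq_or_ne a b
  · exact Q.chirotope_self_left a a
  · rw [chirotope, Q.line_right hab, sub_self, mul_zero, sign_zero]

theorem chirotope_swap_left (a b c : V) : Q.chirotope b a c = -Q.chirotope a b c := by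
  rw [chirotope, chirotope, Sym2.eq_swap, ← Left.sign_neg]
  congr 1
  ring

theorem chirotope_ne_zero (hab : a ≠ b) (hbc : b ≠ c) (hac : a ≠ c) : Q.chirotope a b c ≠ 0 := by
  rw [chirotope, sign_ne_zero]
  refine mul_ne_zero (sub_ne_zero.2 (Q.fst_ne hab.symm)) (sub_ne_zero.2 fun h => ?_)
  rw [Q.mem_line_iff _ (by simpa using hab)] at h
  rcases Sym2.mem_iff.1 h with h | h
  exacts [hac h.symm, hbc h.symm]

theorem chirotope_eq_sign_mul_sign (hac : a ≠ c) :
    Q.chirotope a b c = SignType.sign ((Q.pt b).1 - (Q.pt a).1) *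
      SignType.sign (Q.line s(a, c) (Q.pt c).1 - Q.line s(a, b) (Q.pt c).1) := by
  rw [chirotope, sign_mul, Q.line_right hac]

theorem exists_sign_line_sub_line (hab : a ≠ b) (hbc : b ≠ c) (hac : a ≠ c) :
    ∃ σ : SignType, ∀ x, SignType.sign (Q.line s(a, c) x - Q.line s(a, b) x) =
      σ * SignType.sign (x - (Q.pt a).1) := by
  refine (Q.crossOnce s(a, c) s(a, b) (by simpa using hac) (by simpa using hab)
    fun h => hbc ?_).exists_sign_sub_eq (by rw [Q.line_left hac, Q.line_left hab])
  exact (Sym2.congr_right.1 h).symm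

theorem chirotope_swap_right (a b c : V) : Q.chirotope a c b = -Q.chirotope a b c := by
  obtain rfl | hab := eq_or_ne a b
  · rw [chirotope_swap_left, chirotope_self_right, chirotope_self_left, neg_zero]
  obtain rfl | hac := eq_or_ne a c
  · rw [Q.chirotope_swap_left b, chirotope_self_right, chirotope_self_left, neg_zero, neg_zero]
  obtain rfl | hbc := eq_or_ne b c
  · rw [chirotope_self_right, neg_zero]
  obtain ⟨σ, hσ⟩ := Q.exists_sign_line_sub_line hab hbc hac
  rw [Q.chirotope_eq_sign_mul_sign hac, Q.chirotope_eq_sign_mul_sign hab,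
    ← neg_sub (Q.line s(a, c) _), Left.sign_neg, hσ, hσ, mul_neg, mul_left_comm,
    mul_left_comm _ σ, mul_comm (SignType.sign ((Q.pt c).1 - _))]

theorem line_lt_line_of_chirotope_eq_one (hb : (Q.pt a).1 ≤ (Q.pt b).1)
    (hc : (Q.pt a).1 ≤ (Q.pt c).1) (h : Q.chirotope a b c = 1) {x : ℝ} (hx : (Q.pt a).1 < x) :
    Q.line s(a, b) x < Q.line s(a, c) x := by
  have hab : a ≠ b := by rintro rfl; simp [chirotope_self_left] at h
  have hac : a ≠ c := by rintro rfl; simp [Q.chirotope_swap_right a a, chirotope_self_left] at h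
  have hbc : b ≠ c := by rintro rfl; simp [chirotope_self_right] at h
  obtain ⟨σ, hσ⟩ := Q.exists_sign_line_sub_line hab hbc hac
  obtain rfl : σ = 1 := by
    rwa [Q.chirotope_eq_sign_mul_sign hac, hσ, sign_pos (sub_pos.2 (hb.lt_of_ne (Q.fst_ne hab))),
      sign_pos (sub_pos.2 (hc.lt_of_ne (Q.fst_ne hac))), one_mul, mul_one] at h
  rw [← sub_pos, ← sign_eq_one_iff, hσ, one_mul, sign_pos (sub_pos.2 hx)]

theorem not_surrounded_of_leftmost (hb : (Q.pt a).1 ≤ (Q.pt b).1) (hc : (Q.pt a).1 ≤ (Q.pt c).1)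
    (hd : (Q.pt a).1 ≤ (Q.pt d).1) :
    ¬ (Q.chirotope a b c = 1 ∧ Q.chirotope a c d = 1 ∧ Q.chirotope a d b = 1) :=
  fun ⟨hbc, hcd, hdb⟩ =>
    (((Q.line_lt_line_of_chirotope_eq_one hb hc hbc (lt_add_one _)).trans
      (Q.line_lt_line_of_chirotope_eq_one hc hd hcd (lt_add_one _))).trans
        (Q.line_lt_line_of_chirotope_eq_one hd hb hdb (lt_add_one _))).false

theorem chirotope_rotate (a b c : V) : Q.chirotope b c a = Q.chirotope a b c := by
  rw [Q.chirotope_swap_right b a c, Q.chirotope_swap_left a b c, neg_neg]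

/-- Otherwise `t`, `a`, `b` and `c` would each be surrounded by the other three, although one of
them is leftmost. -/
theorem chirotope_interior (t a b c : V) (hab : Q.chirotope t a b = 1)
    (hbc : Q.chirotope t b c = 1) (hca : Q.chirotope t c a = 1) : Q.chirotope a b c = 1 := by
  by_contra habc
  have ne_of_eq_one : ∀ {x y}, Q.chirotope t x y = 1 → x ≠ y := by
    rintro x _ h rfl
    simp [chirotope_self_right] at h
  have hbac : Q.chirotope b a c = 1 := by
    rw [chirotope_swap_left]
    have hne := Q.chirotope_ne_zero (ne_of_eq_one hab) (ne_of_eq_one hbc) (ne_of_eq_one hca).symm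
    generalize Q.chirotope a b c = s at habc hne ⊢
    decide +revert
  classical
  obtain ⟨x, hx, hmin⟩ := Finset.exists_min_image {t, a, b, c} (fun y => (Q.pt y).1) ⟨t, by simp⟩
  simp only [Finset.mem_insert, Finset.mem_singleton, forall_eq_or_imp, forall_eq] at hx hmin
  obtain ⟨ht, ha, hb, hc⟩ := hmin
  have rotate := Q.chirotope_rotate
  rcases hx with rfl | rfl | rfl | rfl
  · exact Q.not_surrounded_of_leftmost ha hb hc ⟨hab, hbc, hca⟩
  · exact Q.not_surrounded_of_leftmost hb ht hc
      ⟨by rwa [rotate], by rwa [← rotate], by rwa [rotate]⟩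
  · exact Q.not_surrounded_of_leftmost hc ht ha ⟨by rwa [rotate], by rwa [← rotate], hbac⟩
  · exact Q.not_surrounded_of_leftmost ha ht hb
      ⟨by rwa [rotate], by rwa [← rotate], by rwa [← rotate]⟩

theorem isInteriorTripleSystem : IsInteriorTripleSystem Q.chirotope where
  swap_left := Q.chirotope_swap_left
  rotate := Q.chirotope_rotate
  ne_zero _ _ _ := Q.chirotope_ne_zero
  interior := Q.chirotope_interior

end GeneralizedConfiguration

/-! ### Radial systems of chirotopes -/

theorem CcwAround.rotate_iff {V : Type*} {χ : V → V → V → SignType} {i j l m : V} :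
    CcwAround χ i j l m ↔ CcwAround χ i l m j := by
  unfold CcwAround
  tauto

theorem pointChirotope_swap_left {V : Type*} (p : V → ℝ × ℝ) (a b c : V) :
    pointChirotope p b a c = -pointChirotope p a b c := by
  rw [pointChirotope, pointChirotope, ← Left.sign_neg]
  congr 1
  ring

theorem pointChirotope_rotate {V : Type*} (p : V → ℝ × ℝ) (a b c : V) :
    pointChirotope p b c a = pointChirotope p a b c := by
  rw [pointChirotope, pointChirotope]
  congr 1
  ring

theorem pointChirotope_swap_right {V : Type*} (p : V → ℝ × ℝ) (a b c : V) :
    pointChirotope p a b c = -pointChirotope p a c b := by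
  rw [← pointChirotope_rotate, pointChirotope_swap_left, pointChirotope_rotate]

theorem GeneralPosition.of_pointChirotope_ne_zero {V : Type*} {p : V → ℝ × ℝ}
    (hV : 3 ≤ Cardinal.mk V)
    (hp : ∀ a b c : V, a ≠ b → b ≠ c → a ≠ c → pointChirotope p a b c ≠ 0) :
    GeneralPosition p := by
  refine ⟨fun a b hab => ?_, hp⟩
  by_contra hne
  obtain ⟨c, hca, hcb⟩ := Cardinal.exists_ne_ne_of_three_le hV a b
  refine hp a b c hne hcb.symm hca.symm ?_
  rw [pointChirotope, hab, sub_self, sub_self, zero_mul, zero_mul, sub_zero, sign_zero]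

/-- The three numbers are distinct and in this cyclic order. -/
def CyclicLT (a b c : ℤ) : Prop := (a < b ∧ b < c) ∨ (b < c ∧ c < a) ∨ (c < a ∧ a < b)

namespace RadialSystem

variable {V W : Type*}

theorem Ccw.ne {R : RadialSystem V} {i j l m : V} (h : R.Ccw i j l m) :
    j ≠ l ∧ l ≠ m ∧ j ≠ m := by
  obtain ⟨hj, hl, hm, h⟩ := h
  let _ := R.order i
  refine ⟨?_, ?_, ?_⟩ <;> rintro rfl
  exacts [sbtw_irrefl_left h, sbtw_irrefl_right h, sbtw_irrefl_left_right h]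

theorem IsRadialSystemOf.ccwAround {R : RadialSystem V} {χ : V → V → V → SignType}
    (hR : R.IsRadialSystemOf χ) {i j l m : V} (h : R.Ccw i j l m) : CcwAround χ i j l m :=
  have ⟨hjl, hlm, hjm⟩ := h.ne
  have ⟨hj, hl, hm, _⟩ := h
  (hR i j l m hj hl hm hjl hlm hjm).1 h

/-- The radial system with integer keys: the cyclic ordering around `i` is the one of the numbers
`key i j`. -/
def ofKey (key : V → V → ℤ) (hkey : ∀ i j l, j ≠ i → l ≠ i → key i j = key i l → j = l) :
    RadialSystem V where
  order i := circularOrderComap (LinearOrder.toCircularOrder ℤ)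
    (fun j : {j : V // j ≠ i} => key i j.1)
    (fun j l h => Subtype.ext (hkey i j.1 l.1 j.2 l.2 h))

theorem ofKey_ccw {key : V → V → ℤ}
    {hkey : ∀ i j l, j ≠ i → l ≠ i → key i j = key i l → j = l} {i j l m : V} :
    (ofKey key hkey).Ccw i j l m ↔
      j ≠ i ∧ l ≠ i ∧ m ≠ i ∧ CyclicLT (key i j) (key i l) (key i m) :=
  ⟨fun ⟨hj, hl, hm, h⟩ => ⟨hj, hl, hm, h⟩, fun ⟨hj, hl, hm, h⟩ => ⟨hj, hl, hm, h⟩⟩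

theorem comap_ccw {R : RadialSystem V} {f : W ↪ V} {i j l m : W} :
    (R.comap f).Ccw i j l m ↔ R.Ccw (f i) (f j) (f l) (f m) :=
  ⟨fun ⟨hj, hl, hm, h⟩ => ⟨f.injective.ne hj, f.injective.ne hl, f.injective.ne hm, h⟩,
    fun ⟨hj, hl, hm, h⟩ => ⟨ne_of_apply_ne f hj, ne_of_apply_ne f hl, ne_of_apply_ne f hm, h⟩⟩

theorem IsRealizedByPoints.comap {R : RadialSystem V} {p : V → ℝ × ℝ}
    (h : R.IsRealizedByPoints p) (f : W ↪ V) : (R.comap f).IsRealizedByPoints (p ∘ f) :=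
  ⟨⟨h.1.1.comp f.injective, fun a b c hab hbc hac =>
      h.1.2 (f a) (f b) (f c) (f.injective.ne hab) (f.injective.ne hbc) (f.injective.ne hac)⟩,
    fun i j l m hj hl hm hjl hlm hjm => comap_ccw.trans
      (h.2 (f i) (f j) (f l) (f m) (f.injective.ne hj) (f.injective.ne hl) (f.injective.ne hm)
        (f.injective.ne hjl) (f.injective.ne hlm) (f.injective.ne hjm))⟩

theorem RealizableAsPointSet.induce_of_subset_range {R : RadialSystem V} {f : W ↪ V}
    (h : (R.comap f).RealizableAsPointSet) {S : Set V} (hS : S ⊆ Set.range f) :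
    (R.induce S).RealizableAsPointSet := by
  obtain ⟨p, hp⟩ := h
  obtain ⟨e, he⟩ : ∃ e : S ↪ W, ∀ x, f (e x) = x := by
    choose g hg using fun x : S => hS x.2
    exact ⟨⟨g, fun x y hxy => Subtype.ext (by rw [← hg x, ← hg y, hxy])⟩, hg⟩
  refine ⟨p ∘ e, (hp.comap e).1, fun i j l m hj hl hm hjl hlm hjm => ?_⟩
  rw [← (hp.comap e).2 i j l m hj hl hm hjl hlm hjm, comap_ccw, comap_ccw, induce, comap_ccw]
  simp only [Function.Embedding.subtype_apply, he]

end RadialSystem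

/-! ### The radial system of the double circle with an additional vertex -/

namespace DCVertex

variable {k : ℕ}

/-- The position of a point of the double circle along its boundary `v 0, w 0, v 1, w 1, …`; the
points at even positions are the vertices of the regular polygon. -/
def position : Fin k ⊕ Fin k → ℤ
  | Sum.inl i => 2 * (i : ℕ)
  | Sum.inr i => 2 * (i : ℕ) + 1

/-- The number of steps along the boundary of the double circle from `x` to `y`. -/
def gap (x y : Fin k ⊕ Fin k) : ℤ :=
  if position x ≤ position y then position y - position x else position y - position x + 2 * k

theorem position_nonneg (x : Fin k ⊕ Fin k) : 0 ≤ position x := by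
  rcases x with i | i <;> simp only [position] <;> omega

theorem position_lt (x : Fin k ⊕ Fin k) : position x < 2 * k := by
  rcases x with i | i <;> simp only [position] <;> omega

theorem position_injective : Function.Injective (position (k := k)) := by
  rintro (i | i) (j | j) h <;> simp only [position] at h
  · exact congrArg _ (Fin.ext (by omega))
  · omega
  · omega
  · exact congrArg _ (Fin.ext (by omega))

theorem exists_position_eq {t : ℕ} (ht : t < 2 * k) : ∃ x : Fin k ⊕ Fin k, position x = t := by
  obtain ⟨s, rfl | rfl⟩ := t.even_or_odd'
  · exact ⟨Sum.inl ⟨s, by omega⟩, by simp [position]⟩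
  · exact ⟨Sum.inr ⟨s, by omega⟩, by simp [position]⟩

theorem gap_spec (x y : Fin k ⊕ Fin k) :
    (position x ≤ position y ∧ gap x y = position y - position x ∨
      position y < position x ∧ gap x y = position y - position x + 2 * k) ∧
    (0 ≤ position x ∧ position x < 2 * k) ∧ 0 ≤ position y ∧ position y < 2 * k := by
  have := position_nonneg x; have := position_lt x
  have := position_nonneg y; have := position_lt y
  unfold gap
  split_ifs <;> omega

theorem gap_injective (x : Fin k ⊕ Fin k) : Function.Injective (gap x) := fun y z h =>
  position_injective (by have := gap_spec x y; have := gap_spec x z; have := gap_spec y z; omega)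

theorem gap_self (x : Fin k ⊕ Fin k) : gap x x = 0 := by
  rw [gap, if_pos le_rfl, sub_self]

theorem gap_nonneg (x y : Fin k ⊕ Fin k) : 0 ≤ gap x y := by
  have := gap_spec x y
  omega

theorem gap_pos {x y : Fin k ⊕ Fin k} (h : y ≠ x) : 0 < gap x y := by
  have := gap_spec x y
  have := position_injective.ne h
  omega

theorem gap_lt (x y : Fin k ⊕ Fin k) : gap x y < 2 * k := by
  have := gap_spec x y
  omega

theorem cyclicLT_gap_iff (r x y z : Fin k ⊕ Fin k) :
    CyclicLT (gap r x) (gap r y) (gap r z) ↔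
      CyclicLT (position x) (position y) (position z) := by
  have := gap_spec r x; have := gap_spec r y; have := gap_spec r z
  have := gap_spec x y; have := gap_spec y z; have := gap_spec z x
  unfold CyclicLT
  omega

/-- A key for the counterclockwise order of the points of the double circle around the point `x`,
cut open at the outside of the double circle. The gap determines it, except that a vertex of the
polygon sees its two inner neighbours (gap `1` and `2 * k - 1`) directly behind the adjacent
vertices (gap `2` and `2 * k - 2`). -/
def viewAngle (x y : Fin k ⊕ Fin k) : ℤ :=
  if position x % 2 = 0 then
    if gap x y = 1 then 5 else if gap x y = 2 * k - 1 then 4 * k - 5 else 2 * gap x y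
  else 2 * gap x y

theorem viewAngle_of_odd {x : Fin k ⊕ Fin k} (hx : position x % 2 = 1) (y : Fin k ⊕ Fin k) :
    viewAngle x y = 2 * gap x y :=
  if_neg (by omega)

theorem viewAngle_of_even {x : Fin k ⊕ Fin k} (hx : position x % 2 = 0) (y : Fin k ⊕ Fin k) :
    gap x y = 1 ∧ viewAngle x y = 5 ∨
      gap x y ≠ 1 ∧ gap x y = 2 * k - 1 ∧ viewAngle x y = 4 * k - 5 ∨
      gap x y ≠ 1 ∧ gap x y ≠ 2 * k - 1 ∧ viewAngle x y = 2 * gap x y := by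
  unfold viewAngle
  split_ifs <;> simp_all

theorem viewAngle_self (x : Fin k ⊕ Fin k) : viewAngle x x = 0 := by
  rw [viewAngle, gap_self]
  split_ifs <;> omega

theorem viewAngle_pos_iff {x y : Fin k ⊕ Fin k} : 0 < viewAngle x y ↔ y ≠ x := by
  refine ⟨fun h => ?_, fun h => ?_⟩
  · rintro rfl
    exact h.ne' (viewAngle_self y)
  · have := gap_pos h
    unfold viewAngle
    split_ifs <;> omega

theorem viewAngle_injective (x : Fin k ⊕ Fin k) :
    Function.Injective (viewAngle x) := fun y z h => gap_injective x <| by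
  have := gap_spec x y; have := gap_spec x z
  unfold viewAngle at h
  split_ifs at h <;> omega

/-- A key for the cyclic order of the labels around a label. The points of the double circle see the
label `u` outside, and `u` sees them in clockwise order. -/
def angle : DCVertex k → DCVertex k → ℤ
  | some x, some y => viewAngle x y
  | some _, none => 0
  | none, some y => -position y
  | none, none => 0

theorem angle_injective (i j l : DCVertex k) (hj : j ≠ i) (hl : l ≠ i)
    (h : angle i j = angle i l) : j = l := by
  have hpos : ∀ {x y : Fin k ⊕ Fin k}, some y ≠ some x → 0 < viewAngle x y := fun hyx =>
    viewAngle_pos_iff.2 fun h => hyx (congrArg some h)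
  rcases i with _ | x <;> rcases j with _ | y <;> rcases l with _ | z <;> simp only [angle] at h
  · rfl
  · exact absurd rfl hj
  · exact absurd rfl hl
  · exact congrArg some (position_injective (neg_injective h))
  · rfl
  · exact absurd h (hpos hl).ne
  · exact absurd h (hpos hj).ne'
  · exact congrArg some (viewAngle_injective x h)

end DCVertex

open DCVertex

/-- The radial system of the theorem: a double circle whose points all see the additional label `u`
outside. -/
def doubleCircleSystem (k : ℕ) : RadialSystem (DCVertex k) :=
  RadialSystem.ofKey angle angle_injective

section DoubleCircleSystem

variable {k : ℕ}

theorem doubleCircleSystem_ccw {i j l m : DCVertex k} :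
    (doubleCircleSystem k).Ccw i j l m ↔
      j ≠ i ∧ l ≠ i ∧ m ≠ i ∧ CyclicLT (angle i j) (angle i l) (angle i m) :=
  RadialSystem.ofKey_ccw

theorem doubleCircleSystem_ccw_some {x a b c : Fin k ⊕ Fin k} :
    (doubleCircleSystem k).Ccw (some x) (some a) (some b) (some c) ↔
      a ≠ x ∧ b ≠ x ∧ c ≠ x ∧ CyclicLT (viewAngle x a) (viewAngle x b) (viewAngle x c) := by
  simp only [doubleCircleSystem_ccw, angle, ne_eq, Option.some.injEq]

theorem doubleCircleSystem_directlyBetween_of_viewAngle_le {x a b : Fin k ⊕ Fin k}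
    (hb : 0 < viewAngle x b) (hba : viewAngle x b < viewAngle x a)
    (hle : ∀ y, y ≠ x → viewAngle x b ≤ viewAngle x y ∧ viewAngle x y ≤ viewAngle x a) :
    (doubleCircleSystem k).DirectlyBetween (some x) (some a) u (some b) := by
  have hbx := viewAngle_pos_iff.1 hb
  have hax := viewAngle_pos_iff.1 (hb.trans hba)
  refine ⟨doubleCircleSystem_ccw.2 ⟨by simpa using hax, by simp, by simpa using hbx,
    Or.inr (Or.inl ⟨hb, hba⟩)⟩, fun y hy => ?_⟩
  obtain ⟨-, hyx, -, h⟩ := doubleCircleSystem_ccw.1 hy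
  rcases y with _ | y
  · rfl
  · have := hle y fun h => hyx (congrArg some h)
    simp only [angle, CyclicLT] at h
    omega

theorem val_finRotate_cases (i : Fin k) :
    ((i : ℕ) + 1 = k ∧ ((finRotate k i : Fin k) : ℕ) = 0) ∨
      ((i : ℕ) + 1 < k ∧ ((finRotate k i : Fin k) : ℕ) = i + 1) := by
  obtain _ | k := k
  · exact i.elim0
  · obtain rfl | hi := eq_or_ne i (Fin.last k)
    · exact Or.inl ⟨rfl, by rw [finRotate_last]; rfl⟩
    · exact Or.inr ⟨by have := Fin.val_lt_last hi; omega, coe_finRotate_of_ne_last hi⟩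

theorem gap_v_finRotate (hk : 3 ≤ k) (i : Fin k) :
    gap (Sum.inl i) (Sum.inl (finRotate k i)) = 2 := by
  have := gap_spec (Sum.inl i) (Sum.inl (finRotate k i))
  have := val_finRotate_cases i
  simp only [position] at *
  omega

theorem doubleCircleSystem_directlyBetween_v (hk : 3 ≤ k) (i : Fin k) :
    (doubleCircleSystem k).DirectlyBetween (v i) (v ((finRotate k).symm i)) u
      (v (finRotate k i)) := by
  have hnext := gap_v_finRotate hk i
  have hprev : gap (Sum.inl i) (Sum.inl ((finRotate k).symm i)) = 2 * k - 2 := by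
    have h := gap_v_finRotate hk ((finRotate k).symm i)
    rw [Equiv.apply_symm_apply] at h
    have := gap_spec (Sum.inl i) (Sum.inl ((finRotate k).symm i))
    have := gap_spec (Sum.inl ((finRotate k).symm i)) (Sum.inl i)
    omega
  have heven : position (Sum.inl i) % 2 = 0 := Int.mul_emod_right 2 i
  have := viewAngle_of_even heven (Sum.inl (finRotate k i))
  have := viewAngle_of_even heven (Sum.inl ((finRotate k).symm i))
  refine doubleCircleSystem_directlyBetween_of_viewAngle_le (by omega) (by omega) fun y hy => ?_
  have := viewAngle_of_even heven y
  have := gap_pos hy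
  have := gap_lt (Sum.inl i) y
  omega

theorem doubleCircleSystem_directlyBetween_w (hk : 3 ≤ k) (i : Fin k) :
    (doubleCircleSystem k).DirectlyBetween (w i) (v i) u (v (finRotate k i)) := by
  have hnext : gap (Sum.inr i) (Sum.inl (finRotate k i)) = 1 := by
    have := gap_spec (Sum.inl i) (Sum.inl (finRotate k i))
    have := gap_spec (Sum.inr i) (Sum.inl (finRotate k i))
    have := gap_v_finRotate hk i
    simp only [position] at *
    omega
  have hprev : gap (Sum.inr i) (Sum.inl i) = 2 * k - 1 := by
    have := gap_spec (Sum.inr i) (Sum.inl i)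
    simp only [position] at *
    omega
  have hodd : position (Sum.inr i) % 2 = 1 := by
    simp only [position]
    omega
  refine doubleCircleSystem_directlyBetween_of_viewAngle_le ?_ ?_ fun y hy => ?_ <;>
    simp only [viewAngle_of_odd hodd, hnext, hprev]
  · omega
  · omega
  · have := gap_pos hy
    have := gap_lt (Sum.inr i) y
    omega

end DoubleCircleSystem

/-! ### Non-realizability -/

namespace DCVertex

variable {k : ℕ}

/-- The inner point `y` of the double circle belongs to the edge from `x` to `z` of the polygon. -/
def InPocket (x y z : Fin k ⊕ Fin k) : Prop :=
  position y % 2 = 1 ∧ gap x y = 1 ∧ gap y z = 1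

variable {χ : DCVertex k → DCVertex k → DCVertex k → SignType}

/-- The label `u` lies beyond the edge from `x` to `z`, so `x`, `u`, `z`, `y` is a convex
quadrilateral. -/
theorem chirotope_of_inPocket (hk : 3 ≤ k) (hχ : IsInteriorTripleSystem χ)
    (hR : (doubleCircleSystem k).IsRadialSystemOf χ) {x y z : Fin k ⊕ Fin k}
    (h : InPocket x y z) :
    χ (some x) u (some z) = 1 ∧ χ (some x) u (some y) = 1 ∧ χ (some y) u (some z) = 1 := by
  obtain ⟨hy, hxy, hyz⟩ := h
  have hxy' := gap_spec x y
  have hyz' := gap_spec y z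
  have hx := viewAngle_of_even (x := x) (by omega)
  have hz := viewAngle_of_even (x := z) (by omega)
  have hviewx : CyclicLT 0 (viewAngle x z) (viewAngle x y) := by
    have := hx y; have := hx z; have := gap_spec x z
    unfold CyclicLT
    omega
  have hviewz : CyclicLT (viewAngle z y) (viewAngle z x) 0 := by
    have := hz y; have := hz x; have := gap_spec z x; have := gap_spec z y
    unfold CyclicLT
    omega
  have hviewu : CyclicLT (-position z) (-position y) (-position x) := by
    unfold CyclicLT
    omega
  have hne : x ≠ y ∧ y ≠ z ∧ x ≠ z := by
    refine ⟨?_, ?_, ?_⟩ <;> rintro rfl <;> omega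
  have hconvex := hχ.eq_one_of_convex (a := some x) (b := u) (c := some z) (d := some y)
    (hR.ccwAround (doubleCircleSystem_ccw.2 ⟨nofun, by simpa using hne.2.2.symm,
      by simpa using hne.1.symm, hviewx⟩))
    (hR.ccwAround (doubleCircleSystem_ccw.2 ⟨nofun, nofun, nofun, hviewu⟩))
    (hR.ccwAround (doubleCircleSystem_ccw.2 ⟨by simpa using hne.2.1, by simpa using hne.2.2,
      nofun, hviewz⟩))
  exact ⟨hconvex.1, hconvex.2.1, (hχ.rotate _ _ _).symm.trans hconvex.2.2.2⟩

theorem chirotope_of_viewAngle_lt (hχ : IsInteriorTripleSystem χ)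
    (hR : (doubleCircleSystem k).IsRadialSystemOf χ) {x a b c : Fin k ⊕ Fin k}
    (hx : 0 < viewAngle x a ∧ viewAngle x a < viewAngle x b ∧ viewAngle x b < viewAngle x c)
    (ha : 0 < viewAngle a b ∧ viewAngle a b < viewAngle a c ∧ viewAngle a c < viewAngle a x)
    (hb : 0 < viewAngle b c ∧ viewAngle b c < viewAngle b x ∧ viewAngle b x < viewAngle b a) :
    χ (some x) (some a) (some b) = 1 ∧ χ (some x) (some b) (some c) = 1 := by
  have ccwAround : ∀ {o p q r : Fin k ⊕ Fin k}, 0 < viewAngle o p ∧ viewAngle o p < viewAngle o q ∧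
      viewAngle o q < viewAngle o r → CcwAround χ (some o) (some p) (some q) (some r) :=
    fun ⟨hp, hpq, hqr⟩ => hR.ccwAround (doubleCircleSystem_ccw_some.2
      ⟨viewAngle_pos_iff.1 hp, viewAngle_pos_iff.1 (hp.trans hpq),
        viewAngle_pos_iff.1 ((hp.trans hpq).trans hqr), Or.inl ⟨hpq, hqr⟩⟩)
  have hconvex := hχ.eq_one_of_convex (ccwAround hx) (ccwAround ha) (ccwAround hb)
  exact ⟨hconvex.1, hconvex.2.2.1⟩

theorem chirotope_fan_of_even (hχ : IsInteriorTripleSystem χ)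
    (hR : (doubleCircleSystem k).IsRadialSystemOf χ) {o x y z : Fin k ⊕ Fin k}
    (ho : position o = 0) (hx : position x % 2 = 0) (hx₂ : 2 ≤ position x)
    (hy : position y = position x + 1) (hz : position z = position x + 3) :
    χ (some o) (some x) (some y) = 1 := by
  have viewo := viewAngle_of_even (x := o) (by omega)
  have viewx := viewAngle_of_even hx
  have viewy := viewAngle_of_odd (x := y) (by omega)
  refine (chirotope_of_viewAngle_lt (c := z) hχ hR ?_ ?_ ?_).1
  · have := viewo x; have := viewo y; have := viewo z
    have := gap_spec o x; have := gap_spec o y; have := gap_spec o z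
    omega
  · have := viewx o; have := viewx y; have := viewx z
    have := gap_spec x o; have := gap_spec x y; have := gap_spec x z
    omega
  · have := viewy o; have := viewy x; have := viewy z
    have := gap_spec y o; have := gap_spec y x; have := gap_spec y z
    omega

theorem chirotope_fan_of_odd (hχ : IsInteriorTripleSystem χ)
    (hR : (doubleCircleSystem k).IsRadialSystemOf χ) {o w x y : Fin k ⊕ Fin k}
    (ho : position o = 0) (hx : position x % 2 = 1) (hx₂ : 2 ≤ position x)
    (hw : position x = position w + 2) (hy : position y = position x + 1) :
    χ (some o) (some x) (some y) = 1 := by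
  have viewo := viewAngle_of_even (x := o) (by omega)
  have vieww := viewAngle_of_odd (x := w) (by omega)
  have viewx := viewAngle_of_odd hx
  refine (chirotope_of_viewAngle_lt (a := w) hχ hR ?_ ?_ ?_).2
  · have := viewo w; have := viewo x; have := viewo y
    have := gap_spec o w; have := gap_spec o x; have := gap_spec o y
    omega
  · have := vieww o; have := vieww x; have := vieww y
    have := gap_spec w o; have := gap_spec w x; have := gap_spec w y
    omega
  · have := viewx o; have := viewx w; have := viewx y
    have := gap_spec x o; have := gap_spec x w; have := gap_spec x y
    omega

theorem chirotope_fan (hχ : IsInteriorTripleSystem χ)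
    (hR : (doubleCircleSystem k).IsRadialSystemOf χ) {L : ℕ → Fin k ⊕ Fin k}
    (hL : ∀ t < 2 * k, position (L t) = t) {t : ℕ} (ht : 2 ≤ t) (htk : t < 2 * k - 2) :
    χ (some (L 0)) (some (L t)) (some (L (t + 1))) = 1 := by
  have hL₀ := hL 0 (by omega)
  have hLt := hL t (by omega)
  have hLt₁ := hL (t + 1) (by omega)
  rcases t.mod_two_eq_zero_or_one with hpar | hpar
  · have hLt₃ := hL (t + 3) (by omega)
    exact chirotope_fan_of_even hχ hR (z := L (t + 3)) hL₀ (by omega) (by omega) (by omega)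
      (by omega)
  · have hLt₂ := hL (t - 2) (by omega)
    exact chirotope_fan_of_odd hχ hR (w := L (t - 2)) hL₀ (by omega) (by omega) (by omega)
      (by omega)

end DCVertex

theorem IsInteriorTripleSystem.not_isRadialSystemOf_doubleCircleSystem {k : ℕ} (hk : 3 ≤ k)
    {χ : DCVertex k → DCVertex k → DCVertex k → SignType} (hχ : IsInteriorTripleSystem χ) :
    ¬ (doubleCircleSystem k).IsRadialSystemOf χ := by
  intro hR
  have : Nonempty (Fin k ⊕ Fin k) := ⟨Sum.inl ⟨0, by omega⟩⟩
  choose! L hL using fun t : ℕ => exists_position_eq (k := k) (t := t)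
  have pocket : ∀ {t z}, t % 2 = 0 → t + 1 < 2 * k →
      (position z = t + 2 ∨ t + 2 = 2 * k ∧ position z = 0) → InPocket (L t) (L (t + 1)) z := by
    intro t z ht htk hz
    have h₀ := hL t (by omega); have h₁ := hL (t + 1) htk
    have := gap_spec (L t) (L (t + 1)); have := gap_spec (L (t + 1)) z
    exact ⟨by omega, by omega, by omega⟩
  have hbase : χ (some (L 0)) u (some (L 2)) = 1 :=
    (chirotope_of_inPocket hk hχ hR (pocket rfl (by omega) (Or.inl (hL 2 (by omega))))).1
  have hedge : ∀ t, 2 ≤ t → t < 2 * k - 2 → χ (some (L t)) u (some (L (t + 1))) = 1 := by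
    intro t ht htk
    rcases t.mod_two_eq_zero_or_one with hpar | hpar
    · have hz := hL (t + 2) (by omega)
      exact (chirotope_of_inPocket hk hχ hR (pocket hpar (by omega) (Or.inl hz))).2.1
    · obtain ⟨s, rfl⟩ : ∃ s, t = s + 1 := ⟨t - 1, by omega⟩
      have hz := hL (s + 2) (by omega)
      exact (chirotope_of_inPocket hk hχ hR (pocket (by omega) (by omega) (Or.inl hz))).2.2
  have hbeyond : χ (some (L 0)) u (some (L (2 * k - 2))) = 1 :=
    hχ.beyond_fan (p := fun t => some (L t)) (by omega) hbase
      (fun t => chirotope_fan hχ hR hL) hedge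
  have hlast : χ (some (L (2 * k - 2))) u (some (L 0)) = 1 :=
    (chirotope_of_inPocket hk hχ hR
      (pocket (by omega) (by omega) (Or.inr ⟨by omega, hL 0 (by omega)⟩))).1
  have hcontra := (hχ.rotate (some (L (2 * k - 2))) u (some (L 0))).trans hlast
  rw [hχ.swap_left, hbeyond] at hcontra
  exact absurd hcontra (by decide)

theorem doubleCircleSystem_not_realizableAsAbstractOrderType {k : ℕ} (hk : 3 ≤ k) :
    ¬ (doubleCircleSystem k).RealizableAsAbstractOrderType := fun ⟨Q, hQ⟩ =>
  Q.isInteriorTripleSystem.not_isRadialSystemOf_doubleCircleSystem hk hQ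

/-! ### Orientations of the double circle -/

namespace DCVertex

variable {k : ℕ}

/-- The three points are an inner point of the double circle and the endpoints of its edge, in the
cyclic order of the boundary. -/
def IsPocket (x y z : Fin k ⊕ Fin k) : Prop := InPocket x y z ∨ InPocket y z x ∨ InPocket z x y

/-- The triples that are oriented counterclockwise in the double circle: the orientation is the
cyclic order along the boundary, except that it is reversed for the pockets. -/
def DoubleCircleCcw (x y z : Fin k ⊕ Fin k) : Prop :=
  (CyclicLT (position x) (position y) (position z) ∧ ¬ IsPocket x y z) ∨ IsPocket x z y

theorem gap_cases (x y z : Fin k ⊕ Fin k) :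
    (gap x y ≤ gap x z ∧ gap y z = gap x z - gap x y) ∨
      (gap x z < gap x y ∧ gap y z = gap x z - gap x y + 2 * k) := by
  have := gap_spec x y; have := gap_spec x z; have := gap_spec y z
  omega

theorem position_emod_two (x y : Fin k ⊕ Fin k) :
    position y % 2 = (position x + gap x y) % 2 := by
  have := gap_spec x y
  omega

theorem cyclicLT_position_iff {x y z : Fin k ⊕ Fin k} (hxy : x ≠ y) (hxz : x ≠ z) :
    CyclicLT (position x) (position y) (position z) ↔ gap x y < gap x z := by
  have := gap_pos hxy.symm; have := gap_pos hxz.symm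
  rw [← cyclicLT_gap_iff x, gap_self, CyclicLT]
  omega

theorem isPocket_iff_of_even (hk : 3 ≤ k) {x y z : Fin k ⊕ Fin k} (hx : position x % 2 = 0) :
    IsPocket x y z ↔
      (gap x y = 1 ∧ gap x z = 2) ∨ (gap x y = 2 * k - 2 ∧ gap x z = 2 * k - 1) := by
  have := gap_cases x y z; have := gap_cases x z x; have := gap_self x
  have := gap_nonneg x y; have := gap_lt x y
  have := gap_nonneg x z; have := gap_lt x z
  have := position_emod_two x y; have := position_emod_two x z
  unfold IsPocket InPocket
  omega

theorem isPocket_iff_of_odd (hk : 3 ≤ k) {x y z : Fin k ⊕ Fin k} (hx : position x % 2 = 1) :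
    IsPocket x y z ↔ gap x y = 1 ∧ gap x z = 2 * k - 1 := by
  have := gap_cases x y z; have := gap_cases x z x; have := gap_self x
  have := gap_nonneg x y; have := gap_lt x y
  have := gap_nonneg x z; have := gap_lt x z
  have := position_emod_two x y; have := position_emod_two x z
  unfold IsPocket InPocket
  omega

theorem doubleCircleCcw_iff_of_even (hk : 3 ≤ k) {x y z : Fin k ⊕ Fin k} (hx : position x % 2 = 0)
    (hxy : x ≠ y) (hyz : y ≠ z) (hxz : x ≠ z) :
    DoubleCircleCcw x y z ↔ viewAngle x y < viewAngle x z := by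
  rw [DoubleCircleCcw, cyclicLT_position_iff hxy hxz, isPocket_iff_of_even hk hx,
    isPocket_iff_of_even hk hx]
  have := viewAngle_of_even hx y; have := viewAngle_of_even hx z
  have := gap_pos hxy.symm; have := gap_lt x y
  have := gap_pos hxz.symm; have := gap_lt x z
  have := (gap_injective x).ne hyz
  omega

theorem doubleCircleCcw_iff_of_odd (hk : 3 ≤ k) {x y z : Fin k ⊕ Fin k} (hx : position x % 2 = 1)
    (hxy : x ≠ y) (hxz : x ≠ z) :
    DoubleCircleCcw x y z ↔ (gap x y < gap x z ∧ ¬ (gap x y = 1 ∧ gap x z = 2 * k - 1)) ∨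
      (gap x z = 1 ∧ gap x y = 2 * k - 1) := by
  rw [DoubleCircleCcw, cyclicLT_position_iff hxy hxz, isPocket_iff_of_odd hk hx,
    isPocket_iff_of_odd hk hx]

theorem cyclicLT_viewAngle_iff (hk : 3 ≤ k) {x a b c : Fin k ⊕ Fin k} (hxa : x ≠ a) (hxb : x ≠ b)
    (hxc : x ≠ c) (hab : a ≠ b) (hbc : b ≠ c) (hac : a ≠ c) :
    CyclicLT (viewAngle x a) (viewAngle x b) (viewAngle x c) ↔
      (DoubleCircleCcw x a b ∧ DoubleCircleCcw x b c) ∨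
        (DoubleCircleCcw x b c ∧ DoubleCircleCcw x c a) ∨
        (DoubleCircleCcw x c a ∧ DoubleCircleCcw x a b) := by
  rcases Int.emod_two_eq_zero_or_one (position x) with hx | hx
  · rw [doubleCircleCcw_iff_of_even hk hx hxa hab hxb,
      doubleCircleCcw_iff_of_even hk hx hxb hbc hxc,
      doubleCircleCcw_iff_of_even hk hx hxc hac.symm hxa, CyclicLT]
  · rw [doubleCircleCcw_iff_of_odd hk hx hxa hxb, doubleCircleCcw_iff_of_odd hk hx hxb hxc,
      doubleCircleCcw_iff_of_odd hk hx hxc hxa, CyclicLT, viewAngle_of_odd hx,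
      viewAngle_of_odd hx, viewAngle_of_odd hx]
    have := (gap_injective x).ne hab; have := (gap_injective x).ne hbc
    have := (gap_injective x).ne hac
    have := gap_lt x a; have := gap_lt x b; have := gap_lt x c
    have := gap_pos hxa.symm; have := gap_pos hxb.symm; have := gap_pos hxc.symm
    omega

/-- The points with labels in `T` have the orientations of the double circle. -/
def IsOrientedAsDoubleCircle (T : Set (Fin k ⊕ Fin k)) (p : Fin k ⊕ Fin k → ℝ × ℝ) : Prop :=
  ∀ x ∈ T, ∀ y ∈ T, ∀ z ∈ T, x ≠ y → y ≠ z → x ≠ z →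
    (pointChirotope p x y z = 1 ↔ DoubleCircleCcw x y z) ∧ pointChirotope p x y z ≠ 0

theorem IsPocket.cyclicLT (hk : 3 ≤ k) {x y z : Fin k ⊕ Fin k} (h : IsPocket x y z) :
    CyclicLT (position x) (position y) (position z) := by
  have := gap_spec x y; have := gap_spec y z; have := gap_spec z x
  unfold IsPocket InPocket at h
  unfold CyclicLT
  omega

theorem isPocket_rotate_iff {x y z : Fin k ⊕ Fin k} : IsPocket y z x ↔ IsPocket x y z := by
  unfold IsPocket
  tauto

theorem isOrientedAsDoubleCircle_of_cyclicLT (hk : 3 ≤ k) {T : Set (Fin k ⊕ Fin k)}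
    {p : Fin k ⊕ Fin k → ℝ × ℝ}
    (hp : ∀ x ∈ T, ∀ y ∈ T, ∀ z ∈ T, CyclicLT (position x) (position y) (position z) →
      (IsPocket x y z → pointChirotope p x y z = -1) ∧
        (¬ IsPocket x y z → pointChirotope p x y z = 1)) :
    IsOrientedAsDoubleCircle T p := by
  intro x hx y hy z hz hxy hyz hxz
  have hasymm : CyclicLT (position x) (position y) (position z) ↔
      ¬ CyclicLT (position x) (position z) (position y) := by
    have := position_injective.ne hxy
    have := position_injective.ne hyz
    have := position_injective.ne hxz
    unfold CyclicLT
    omega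
  by_cases hxyz : CyclicLT (position x) (position y) (position z)
  · have hnot : ¬ IsPocket x z y := fun h => hasymm.1 hxyz (h.cyclicLT hk)
    have h := hp x hx y hy z hz hxyz
    by_cases hpocket : IsPocket x y z
    · simp [DoubleCircleCcw, h.1 hpocket, hpocket, hnot]
    · simp [DoubleCircleCcw, h.2 hpocket, hpocket, hxyz]
  · have h := hp x hx z hz y hy (not_not.1 (mt hasymm.2 hxyz))
    rw [pointChirotope_swap_right]
    by_cases hpocket : IsPocket x z y
    · simp [DoubleCircleCcw, h.1 hpocket, hpocket]
    · simp [DoubleCircleCcw, h.2 hpocket, hpocket, hxyz]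

theorem isOrientedAsDoubleCircle_of_gap_lt (hk : 3 ≤ k) (r : Fin k ⊕ Fin k)
    {T : Set (Fin k ⊕ Fin k)} {p : Fin k ⊕ Fin k → ℝ × ℝ}
    (hpos : ∀ x ∈ T, ∀ y ∈ T, ∀ z ∈ T, gap r x < gap r y → gap r y < gap r z →
      ¬ IsPocket x y z → pointChirotope p x y z = 1)
    (hneg : ∀ x ∈ T, ∀ y ∈ T, ∀ z ∈ T, InPocket x y z → pointChirotope p x y z = -1) :
    IsOrientedAsDoubleCircle T p := by
  refine isOrientedAsDoubleCircle_of_cyclicLT hk fun x hx y hy z hz hxyz => ⟨?_, fun h => ?_⟩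
  · rintro (h | h | h)
    · exact hneg x hx y hy z hz h
    · exact (pointChirotope_rotate p x y z).symm.trans (hneg y hy z hz x hx h)
    · exact (pointChirotope_rotate p z x y).trans (hneg z hz x hx y hy h)
  · rcases (cyclicLT_gap_iff r x y z).2 hxyz with ⟨h₁, h₂⟩ | ⟨h₁, h₂⟩ | ⟨h₁, h₂⟩
    · exact hpos x hx y hy z hz h₁ h₂ h
    · exact (pointChirotope_rotate p x y z).symm.trans
        (hpos y hy z hz x hx h₁ h₂ (isPocket_rotate_iff.not.2 h))
    · exact (pointChirotope_rotate p z x y).trans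
        (hpos z hz x hx y hy h₁ h₂ (isPocket_rotate_iff.not.1 h))

theorem IsOrientedAsDoubleCircle.cyclicLT_iff_ccwAround (hk : 3 ≤ k) {T : Set (Fin k ⊕ Fin k)}
    {p : Fin k ⊕ Fin k → ℝ × ℝ} (hp : IsOrientedAsDoubleCircle T p) {x a b c : Fin k ⊕ Fin k}
    (hx : x ∈ T) (ha : a ∈ T) (hb : b ∈ T) (hc : c ∈ T) (hxa : x ≠ a) (hxb : x ≠ b) (hxc : x ≠ c)
    (hab : a ≠ b) (hbc : b ≠ c) (hac : a ≠ c) :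
    CyclicLT (viewAngle x a) (viewAngle x b) (viewAngle x c) ↔
      CcwAround (pointChirotope p) x a b c := by
  rw [cyclicLT_viewAngle_iff hk hxa hxb hxc hab hbc hac, CcwAround,
    (hp x hx a ha b hb hxa hab hxb).1, (hp x hx b hb c hc hxb hbc hxc).1,
    (hp x hx c hc a ha hxc hac.symm hxa).1]

end DCVertex

/-! ### Realizing the double circle -/

section RegularPolygon

/-- Twice the signed area of a triangle, positive for counterclockwise triangles. -/
def triangleDet {R : Type*} [CommRing R] (A B C : R × R) : R :=
  (B.1 - A.1) * (C.2 - A.2) - (B.2 - A.2) * (C.1 - A.1)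

theorem pointChirotope_eq_sign_triangleDet {V : Type*} (p : V → ℝ × ℝ) (a b c : V) :
    pointChirotope p a b c = SignType.sign (triangleDet (p a) (p b) (p c)) :=
  rfl

theorem triangleDet_midpoint (A B C : Fin 2 → ℝ × ℝ) :
    triangleDet (midpoint ℝ (A 0) (A 1)) (midpoint ℝ (B 0) (B 1)) (midpoint ℝ (C 0) (C 1)) =
      (∑ i : Fin 2 × Fin 2 × Fin 2, triangleDet (A i.1) (B i.2.1) (C i.2.2)) / 8 := by
  simp only [Fintype.sum_prod_type, Fin.sum_univ_two, triangleDet, midpoint_eq_smul_add,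
    Prod.smul_fst, Prod.smul_snd, Prod.fst_add, Prod.snd_add, smul_eq_mul, invOf_eq_inv]
  ring

theorem triangleDet_smul_midpoint (A B : ℝ × ℝ) (ε : ℝ) :
    triangleDet A ((1 - ε) • midpoint ℝ A B) B = -ε * (A.1 * B.2 - A.2 * B.1) := by
  simp only [triangleDet, midpoint_eq_smul_add, Prod.smul_fst, Prod.smul_snd, Prod.fst_add,
    Prod.snd_add, smul_eq_mul, invOf_eq_inv]
  ring

theorem triangleDet_cos_sin (x y z : ℝ) :
    triangleDet (Real.cos (2 * x), Real.sin (2 * x)) (Real.cos (2 * y), Real.sin (2 * y))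
      (Real.cos (2 * z), Real.sin (2 * z)) =
      4 * Real.sin (y - x) * Real.sin (z - y) * Real.sin (z - x) := by
  have hdet : triangleDet (Real.cos (2 * x), Real.sin (2 * x))
      (Real.cos (2 * y), Real.sin (2 * y)) (Real.cos (2 * z), Real.sin (2 * z)) =
      Real.sin (2 * (y - x)) + Real.sin (2 * (z - y)) -
        Real.sin (2 * (y - x) + 2 * (z - y)) := by
    have hadd : 2 * (y - x) + 2 * (z - y) = 2 * z - 2 * x := by ring
    rw [hadd, mul_sub, mul_sub, Real.sin_sub, Real.sin_sub, Real.sin_sub, triangleDet]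
    ring
  have hadd : z - x = (y - x) + (z - y) := by ring
  rw [hdet, hadd, Real.sin_add, Real.sin_add, Real.sin_two_mul, Real.sin_two_mul,
    Real.cos_two_mul', Real.cos_two_mul']
  generalize y - x = p
  generalize z - y = q
  linear_combination (-2 * Real.sin p * Real.cos p) * Real.sin_sq_add_cos_sq q -
    2 * Real.sin q * Real.cos q * Real.sin_sq_add_cos_sq p

variable {k : ℕ}

theorem triangleDet_polygonVertex (a b c : ℕ) :
    triangleDet (polygonVertex k a) (polygonVertex k b) (polygonVertex k c) =
      4 * Real.sin (Real.pi * (((b : ℝ) - a) / k)) * Real.sin (Real.pi * (((c : ℝ) - b) / k)) *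
        Real.sin (Real.pi * (((c : ℝ) - a) / k)) := by
  have hangle : ∀ i : ℕ, 2 * Real.pi * i / k = 2 * (Real.pi * (i / k)) := fun i => by ring
  simp only [polygonVertex, hangle, triangleDet_cos_sin]
  congr 3 <;> ring_nf

theorem sin_pi_mul_div_nonneg {a b : ℕ} (hab : a ≤ b) (hba : b ≤ a + k) :
    0 ≤ Real.sin (Real.pi * (((b : ℝ) - a) / k)) := by
  have hab' : (a : ℝ) ≤ b := by exact_mod_cast hab
  have hba' : (b : ℝ) ≤ a + k := by exact_mod_cast hba
  apply Real.sin_nonneg_of_nonneg_of_le_pi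
  · exact mul_nonneg Real.pi_pos.le (div_nonneg (by linarith) k.cast_nonneg)
  · exact mul_le_of_le_one_right Real.pi_pos.le (div_le_one_of_le₀ (by linarith) k.cast_nonneg)

theorem sin_pi_mul_div_pos {a b : ℕ} (hab : a < b) (hba : b < a + k) :
    0 < Real.sin (Real.pi * (((b : ℝ) - a) / k)) := by
  have hab' : (a : ℝ) < b := by exact_mod_cast hab
  have hba' : (b : ℝ) < a + k := by exact_mod_cast hba
  have hk : (0 : ℝ) < k := by linarith
  apply Real.sin_pos_of_pos_of_lt_pi
  · exact mul_pos Real.pi_pos (div_pos (by linarith) hk)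
  · exact mul_lt_of_lt_one_right Real.pi_pos ((div_lt_one hk).2 (by linarith))

theorem triangleDet_polygonVertex_nonneg {a b c : ℕ} (hab : a ≤ b) (hbc : b ≤ c)
    (hca : c ≤ a + k) :
    0 ≤ triangleDet (polygonVertex k a) (polygonVertex k b) (polygonVertex k c) := by
  rw [triangleDet_polygonVertex]
  have := sin_pi_mul_div_nonneg hab (hbc.trans hca)
  have := sin_pi_mul_div_nonneg hbc (by omega : c ≤ b + k)
  have := sin_pi_mul_div_nonneg (hab.trans hbc) hca
  positivity

theorem triangleDet_polygonVertex_pos {a b c : ℕ} (hab : a < b) (hbc : b < c)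
    (hca : c < a + k) :
    0 < triangleDet (polygonVertex k a) (polygonVertex k b) (polygonVertex k c) := by
  rw [triangleDet_polygonVertex]
  have := sin_pi_mul_div_pos hab (hbc.trans hca)
  have := sin_pi_mul_div_pos hbc (by omega : c < b + k)
  have := sin_pi_mul_div_pos (hab.trans hbc) hca
  positivity

theorem polygonVertex_self (hk : k ≠ 0) : polygonVertex k k = polygonVertex k 0 := by
  simp [polygonVertex, hk]

theorem cross_polygonVertex_succ_pos (hk : 3 ≤ k) (i : ℕ) :
    0 < (polygonVertex k i).1 * (polygonVertex k (i + 1)).2 -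
      (polygonVertex k i).2 * (polygonVertex k (i + 1)).1 := by
  have hk' : (3 : ℝ) ≤ k := by exact_mod_cast hk
  have hcross : (polygonVertex k i).1 * (polygonVertex k (i + 1)).2 -
      (polygonVertex k i).2 * (polygonVertex k (i + 1)).1 = Real.sin (2 * Real.pi / k) := by
    have hangle : 2 * Real.pi / k = 2 * Real.pi * ((i + 1 : ℕ) : ℝ) / k -
        2 * Real.pi * i / k := by
      push_cast
      ring
    rw [hangle, Real.sin_sub]
    simp only [polygonVertex]
    ring
  rw [hcross]
  have hpi := Real.pi_pos
  refine Real.sin_pos_of_pos_of_lt_pi (by positivity) ?_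
  rw [div_lt_iff₀ (by linarith)]
  nlinarith

theorem triangleDet_midpoint_polygonVertex_pos (hk : 3 ≤ k) {s t q : ℕ} (hst : s < t)
    (htq : t < q) (hq : q < 2 * k) (hpocket : ¬ (t % 2 = 1 ∧ t = s + 1 ∧ q = t + 1))
    (hlast : ¬ (s = 0 ∧ t = 2 * k - 2 ∧ q = 2 * k - 1)) :
    0 < triangleDet (midpoint ℝ (polygonVertex k (s / 2)) (polygonVertex k ((s + 1) / 2)))
      (midpoint ℝ (polygonVertex k (t / 2)) (polygonVertex k ((t + 1) / 2)))
      (midpoint ℝ (polygonVertex k (q / 2)) (polygonVertex k ((q + 1) / 2))) := by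
  have hsum := triangleDet_midpoint (fun i => polygonVertex k ((s + i) / 2))
    (fun i => polygonVertex k ((t + i) / 2)) (fun i => polygonVertex k ((q + i) / 2))
  refine lt_of_lt_of_eq (div_pos (Finset.sum_pos' (fun i _ => ?_) ?_) (by norm_num)) hsum.symm
  · have := i.1.isLt; have := i.2.1.isLt; have := i.2.2.isLt
    exact triangleDet_polygonVertex_nonneg (by omega) (by omega) (by omega)
  · obtain ⟨i, j, l, hij, hjl, hli⟩ : ∃ i j l : Fin 2, (s + i) / 2 < (t + j) / 2 ∧
        (t + j) / 2 < (q + l) / 2 ∧ (q + l) / 2 < (s + i) / 2 + k := by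
      simp only [Fin.exists_fin_two, Fin.val_zero, Fin.val_one]
      omega
    exact ⟨(i, j, l), Finset.mem_univ _, triangleDet_polygonVertex_pos hij hjl hli⟩

end RegularPolygon

section DoubleCircle

variable {k : ℕ}

theorem doubleCircle_zero {x : Fin k ⊕ Fin k} {s : ℕ} (hs : position x = s) :
    doubleCircle k 0 x = midpoint ℝ (polygonVertex k (s / 2)) (polygonVertex k ((s + 1) / 2)) := by
  rcases x with i | i <;> simp only [position] at hs
  · rw [show s / 2 = i by omega, show (s + 1) / 2 = i by omega, midpoint_self, doubleCircle]
  · rw [show s / 2 = i by omega, show (s + 1) / 2 = i + 1 by omega, doubleCircle, sub_zero,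
      one_smul]

theorem continuous_doubleCircle (x : Fin k ⊕ Fin k) : Continuous fun ε => doubleCircle k ε x := by
  rcases x with i | i <;> unfold doubleCircle <;> fun_prop

theorem eventually_pointChirotope_doubleCircle_eq_one (hk : 3 ≤ k) {x y z : Fin k ⊕ Fin k}
    (hxy : position x < position y) (hyz : position y < position z) (h : ¬ IsPocket x y z) :
    ∀ᶠ ε in 𝓝[>] (0 : ℝ), pointChirotope (doubleCircle k ε) x y z = 1 := by
  obtain ⟨s, hs⟩ := Int.eq_ofNat_of_zero_le (position_nonneg x)
  obtain ⟨t, ht⟩ := Int.eq_ofNat_of_zero_le (position_nonneg y)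
  obtain ⟨q, hq⟩ := Int.eq_ofNat_of_zero_le (position_nonneg z)
  have hpos : 0 < triangleDet (doubleCircle k 0 x) (doubleCircle k 0 y) (doubleCircle k 0 z) := by
    rw [doubleCircle_zero hs, doubleCircle_zero ht, doubleCircle_zero hq]
    have := gap_spec x y; have := gap_spec y z; have := gap_spec z x
    unfold IsPocket InPocket at h
    exact triangleDet_midpoint_polygonVertex_pos hk (by omega) (by omega) (by omega) (by omega)
      (by omega)
  have hcont : Continuous fun ε =>
      triangleDet (doubleCircle k ε x) (doubleCircle k ε y) (doubleCircle k ε z) := by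
    have := continuous_doubleCircle x
    have := continuous_doubleCircle y
    have := continuous_doubleCircle z
    unfold triangleDet
    fun_prop
  filter_upwards [nhdsWithin_le_nhds (hcont.continuousAt.eventually_const_lt hpos)] with ε hε
  exact sign_pos hε

theorem pointChirotope_doubleCircle_of_inPocket (hk : 3 ≤ k) {x y z : Fin k ⊕ Fin k}
    (h : InPocket x y z) {ε : ℝ} (hε : 0 < ε) : pointChirotope (doubleCircle k ε) x y z = -1 := by
  obtain ⟨hy, hxy, hyz⟩ := h
  have := gap_spec x y; have := gap_spec y z
  rcases x with i | i <;> rcases y with j | j <;> rcases z with l | l <;>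
    simp only [position] at * <;> try omega
  have hz : polygonVertex k l = polygonVertex k (i + 1) := by
    rcases Nat.lt_or_ge (i + 1) k with hi | hi
    · rw [show (l : ℕ) = i + 1 by omega]
    · rw [show (l : ℕ) = 0 by omega, show (i : ℕ) + 1 = k by omega, polygonVertex_self (by omega)]
  rw [pointChirotope_eq_sign_triangleDet, sign_eq_neg_one_iff, doubleCircle, doubleCircle,
    doubleCircle, hz, show (j : ℕ) = i by omega, triangleDet_smul_midpoint]
  exact mul_neg_of_neg_of_pos (neg_lt_zero.2 hε) (cross_polygonVertex_succ_pos hk i)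

theorem eventually_isOrientedAsDoubleCircle_doubleCircle (hk : 3 ≤ k) :
    ∀ᶠ ε in 𝓝[>] (0 : ℝ), IsOrientedAsDoubleCircle Set.univ (doubleCircle k ε) := by
  have hpos : ∀ᶠ ε in 𝓝[>] (0 : ℝ), ∀ x y z : Fin k ⊕ Fin k, position x < position y →
      position y < position z → ¬ IsPocket x y z → pointChirotope (doubleCircle k ε) x y z = 1 := by
    simp only [eventually_all]
    exact fun x y z => eventually_pointChirotope_doubleCircle_eq_one hk
  obtain ⟨r, hr⟩ := exists_position_eq (k := k) (t := 0) (by omega)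
  have hgap : ∀ x, gap r x = position x := by
    intro x
    have := gap_spec r x
    omega
  filter_upwards [hpos, self_mem_nhdsWithin] with ε hpos hε
  refine isOrientedAsDoubleCircle_of_gap_lt hk r (fun x _ y _ z _ => ?_)
    (fun x _ y _ z _ h => pointChirotope_doubleCircle_of_inPocket hk h hε)
  rw [hgap, hgap, hgap]
  exact hpos x y z

theorem eventually_isRealizedByPoints_doubleCircle (hk : 3 ≤ k) :
    ∀ᶠ ε in 𝓝[>] (0 : ℝ), ((doubleCircleSystem k).comap
      Function.Embedding.some).IsRealizedByPoints (doubleCircle k ε) := by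
  have hcard : 3 ≤ Cardinal.mk (Fin k ⊕ Fin k) := by
    rw [Cardinal.mk_fintype, Fintype.card_sum, Fintype.card_fin]
    exact_mod_cast (by omega : 3 ≤ k + k)
  filter_upwards [eventually_isOrientedAsDoubleCircle_doubleCircle hk] with ε hε
  refine ⟨.of_pointChirotope_ne_zero hcard fun a b c hab hbc hac =>
    (hε a trivial b trivial c trivial hab hbc hac).2,
    fun i j l m hj hl hm hjl hlm hjm => ?_⟩
  rw [RadialSystem.comap_ccw]
  refine doubleCircleSystem_ccw_some.trans ?_
  simp only [hj, hl, hm, ne_eq, not_false_eq_true, true_and]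
  exact hε.cyclicLT_iff_ccwAround hk trivial trivial trivial trivial hj.symm hl.symm hm.symm
    hjl hlm hjm

end DoubleCircle

/-! ### Realizing the double circle with `u`, without one of its points -/

theorem pointChirotope_intCast {V : Type*} (p : V → ℤ × ℤ) (a b c : V) :
    pointChirotope (fun x => (((p x).1 : ℝ), ((p x).2 : ℝ))) a b c =
      SignType.sign (triangleDet (p a) (p b) (p c)) := by
  rw [← sign_intCast (α := ℝ), pointChirotope, triangleDet]
  push_cast
  rfl

namespace DCVertex

variable {k : ℕ}

/-- The points of the double circle that come after `r`, as a convex chain along a parabola with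
every second point raised enough to be a dent, but not more, and the label `u` far below it. -/
def latticeChain (r : Fin k ⊕ Fin k) : DCVertex k → ℤ × ℤ
  | some y => (gap r y, 2 * gap r y ^ 2 + 3 * (position y % 2))
  | none => (0, -(5 * (2 * k) ^ 2))

/-- The points of `latticeChain`, in the real plane. -/
def chain (r : Fin k ⊕ Fin k) (x : DCVertex k) : ℝ × ℝ :=
  ((latticeChain r x).1, (latticeChain r x).2)

theorem triangleDet_latticeChain (r x y z : Fin k ⊕ Fin k) :
    triangleDet (latticeChain r (some x)) (latticeChain r (some y)) (latticeChain r (some z)) =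
      2 * (gap r y - gap r x) * (gap r z - gap r y) * (gap r z - gap r x) +
        3 * (position x % 2 * (gap r z - gap r y) - position y % 2 * (gap r z - gap r x) +
          position z % 2 * (gap r y - gap r x)) := by
  simp only [triangleDet, latticeChain]
  ring

theorem triangleDet_latticeChain_pos {r x y z : Fin k ⊕ Fin k} (hxy : gap r x < gap r y)
    (hyz : gap r y < gap r z) (h : ¬ IsPocket x y z) :
    0 < triangleDet (latticeChain r (some x)) (latticeChain r (some y))
      (latticeChain r (some z)) := by
  have hgap : gap x y = gap r y - gap r x ∧ gap y z = gap r z - gap r y := by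
    have := gap_cases r x y; have := gap_cases r y z
    omega
  have hpocket : ¬ (position y % 2 = 1 ∧ gap x y = 1 ∧ gap y z = 1) := fun h' => h (Or.inl h')
  have hx := Int.emod_two_eq_zero_or_one (position x)
  have hy := Int.emod_two_eq_zero_or_one (position y)
  have hz := Int.emod_two_eq_zero_or_one (position z)
  rw [triangleDet_latticeChain, show gap r z - gap r x = gap x y + gap y z by omega, ← hgap.1,
    ← hgap.2]
  have hxy' : 1 ≤ gap x y := by omega
  have hyz' : 1 ≤ gap y z := by omega
  have hx₀ : 0 ≤ position x % 2 * gap y z := mul_nonneg (by omega) (by omega)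
  have hz₀ : 0 ≤ position z % 2 * gap x y := mul_nonneg (by omega) (by omega)
  rcases hy with hy | hy
  · rw [hy]
    have : 0 < gap x y * gap y z * (gap x y + gap y z) := by positivity
    linarith
  · have hprod : 2 ≤ gap x y * gap y z := by
      rcases eq_or_lt_of_le hxy' with hxy₁ | hxy₂
      · rw [← hxy₁]
        omega
      · nlinarith
    rw [hy]
    nlinarith [mul_le_mul_of_nonneg_right hprod (by omega : 0 ≤ gap x y + gap y z)]

theorem triangleDet_latticeChain_of_inPocket {r x y z : Fin k ⊕ Fin k} (hy : y ≠ r) (hz : z ≠ r)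
    (h : InPocket x y z) :
    triangleDet (latticeChain r (some x)) (latticeChain r (some y))
      (latticeChain r (some z)) < 0 := by
  obtain ⟨hodd, hxy, hyz⟩ := h
  have := position_emod_two x y; have := position_emod_two y z
  have := gap_pos hy; have := gap_pos hz
  have := gap_cases r x y; have := gap_cases r y z
  have := gap_lt r x; have := gap_lt r y
  rw [triangleDet_latticeChain, show gap r z = gap r x + 2 by omega,
    show gap r y = gap r x + 1 by omega, show position x % 2 = 0 by omega,
    show position z % 2 = 0 by omega, hodd]
  ring_nf
  decide

theorem isOrientedAsDoubleCircle_chain (hk : 3 ≤ k) (r : Fin k ⊕ Fin k) :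
    IsOrientedAsDoubleCircle {x | x ≠ r} fun x => chain r (some x) := by
  refine isOrientedAsDoubleCircle_of_gap_lt hk r (fun x _ y _ z _ hxy hyz h => ?_)
    (fun x _ y hy z hz h => ?_)
  · exact (pointChirotope_intCast (latticeChain r) _ _ _).trans
      (sign_pos (triangleDet_latticeChain_pos hxy hyz h))
  · exact (pointChirotope_intCast (latticeChain r) _ _ _).trans
      (sign_neg (triangleDet_latticeChain_of_inPocket hy hz h))

theorem pointChirotope_chain_u_of_gap_lt {r x y : Fin k ⊕ Fin k} (h : gap r x < gap r y) :
    pointChirotope (chain r) u (some x) (some y) = -1 := by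
  refine (pointChirotope_intCast (latticeChain r) _ _ _).trans (sign_neg ?_)
  have hx₀ := gap_nonneg r x
  have hx₁ := gap_lt r x
  have hy₁ := gap_lt r y
  have hx := Int.emod_two_eq_zero_or_one (position x)
  have hy := Int.emod_two_eq_zero_or_one (position y)
  simp only [triangleDet, latticeChain]
  have hprod : gap r x * gap r y ≤ (2 * k) ^ 2 := by nlinarith
  have hlin : gap r x < (2 * k) ^ 2 := by nlinarith
  have hdent : gap r x * (position y % 2) - position x % 2 * gap r y ≤ gap r x := by
    rcases hx with hx | hx <;> rcases hy with hy | hy <;> rw [hx, hy] <;> omega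
  nlinarith [mul_nonneg (by linarith : 0 ≤ gap r y - gap r x - 1)
    (by linarith : 0 ≤ 5 * (2 * k) ^ 2 - 2 * (gap r x * gap r y))]

theorem pointChirotope_chain_u {r x y : Fin k ⊕ Fin k} (hxy : x ≠ y) :
    (pointChirotope (chain r) u (some x) (some y) = 1 ↔ gap r y < gap r x) ∧
      pointChirotope (chain r) u (some x) (some y) ≠ 0 := by
  rcases lt_or_gt_of_ne ((gap_injective r).ne hxy) with h | h
  · rw [pointChirotope_chain_u_of_gap_lt h]
    exact ⟨by simpa using h.le, by decide⟩
  · have hswap : pointChirotope (chain r) u (some x) (some y) = 1 := by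
      rw [pointChirotope_swap_right, pointChirotope_chain_u_of_gap_lt h, neg_neg]
    rw [hswap]
    exact ⟨by simpa using h, by decide⟩

theorem gap_lt_gap_iff {r x y : Fin k ⊕ Fin k} (hx : x ≠ r) (hy : y ≠ r) (hxy : x ≠ y) :
    gap r x < gap r y ↔ gap x y < gap x r := by
  rw [← cyclicLT_position_iff hx.symm hy.symm, ← cyclicLT_position_iff hxy hx]
  unfold CyclicLT
  tauto

/-- Around `x`, the label `u` separates the labels that come after `x` in the chain from those that
come before it. -/
theorem viewAngle_lt_viewAngle_iff (hk : 3 ≤ k) {r x a b : Fin k ⊕ Fin k} (hx : x ≠ r) (ha : a ≠ r)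
    (hb : b ≠ r) (hxa : x ≠ a) (hxb : x ≠ b) (hab : a ≠ b) :
    viewAngle x a < viewAngle x b ↔
      (DoubleCircleCcw x a b ∧ gap r b < gap r x) ∨
        (gap r b < gap r x ∧ gap r x < gap r a) ∨
        (gap r x < gap r a ∧ DoubleCircleCcw x a b) := by
  have := gap_lt_gap_iff hx ha hxa
  have := (gap_lt_gap_iff hx hb hxb).not
  have := (gap_injective r).ne hxb
  have := (gap_injective x).ne ha; have := (gap_injective x).ne hb
  have := (gap_injective x).ne hab
  have := gap_pos hxa.symm; have := gap_pos hxb.symm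
  have := gap_lt x a; have := gap_lt x b
  have := gap_lt x r; have := gap_pos hx.symm
  rcases Int.emod_two_eq_zero_or_one (position x) with hpar | hpar
  · rw [doubleCircleCcw_iff_of_even hk hpar hxa hab hxb]
    have := viewAngle_of_even hpar a; have := viewAngle_of_even hpar b
    omega
  · rw [doubleCircleCcw_iff_of_odd hk hpar hxa hxb, viewAngle_of_odd hpar, viewAngle_of_odd hpar]
    omega

theorem chain_ccw_u_right (hk : 3 ≤ k) {r x a b : Fin k ⊕ Fin k} (hx : x ≠ r) (ha : a ≠ r)
    (hb : b ≠ r) (hxa : x ≠ a) (hxb : x ≠ b) (hab : a ≠ b) :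
    (doubleCircleSystem k).Ccw (some x) (some a) (some b) u ↔
      CcwAround (pointChirotope (chain r)) (some x) (some a) (some b) u := by
  have hpos : 0 < viewAngle x a ∧ 0 < viewAngle x b :=
    ⟨viewAngle_pos_iff.2 hxa.symm, viewAngle_pos_iff.2 hxb.symm⟩
  have hview : (doubleCircleSystem k).Ccw (some x) (some a) (some b) u ↔
      viewAngle x a < viewAngle x b := by
    simp only [doubleCircleSystem_ccw, angle, CyclicLT, ne_eq, Option.some.injEq, hxa.symm,
      hxb.symm, reduceCtorEq, not_false_eq_true, true_and]
    omega
  rw [hview, viewAngle_lt_viewAngle_iff hk hx ha hb hxa hxb hab, CcwAround,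
    pointChirotope_rotate _ u (some x) (some b), (pointChirotope_chain_u hxb).1,
    ← pointChirotope_rotate _ (some x) u (some a), (pointChirotope_chain_u hxa.symm).1,
    ← (isOrientedAsDoubleCircle_chain hk r x hx a ha b hb hxa hab hxb).1]
  rfl

theorem chain_ccw_u (r : Fin k ⊕ Fin k) {a b c : Fin k ⊕ Fin k} (hab : a ≠ b) (hbc : b ≠ c)
    (hac : a ≠ c) :
    (doubleCircleSystem k).Ccw u (some a) (some b) (some c) ↔
      CcwAround (pointChirotope (chain r)) u (some a) (some b) (some c) := by
  have hcyclic := cyclicLT_gap_iff r c b a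
  rw [CcwAround, (pointChirotope_chain_u hab).1, (pointChirotope_chain_u hbc).1,
    (pointChirotope_chain_u hac.symm).1]
  simp only [doubleCircleSystem_ccw, angle, CyclicLT, ne_eq, reduceCtorEq, not_false_eq_true,
    true_and] at hcyclic ⊢
  omega

theorem chain_ccw (hk : 3 ≤ k) {r : Fin k ⊕ Fin k} {i j l m : DCVertex k} (hi : i ≠ some r)
    (hj : j ≠ some r) (hl : l ≠ some r) (hm : m ≠ some r) (hji : j ≠ i) (hli : l ≠ i)
    (hmi : m ≠ i) (hjl : j ≠ l) (hlm : l ≠ m) (hjm : j ≠ m) :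
    (doubleCircleSystem k).Ccw i j l m ↔ CcwAround (pointChirotope (chain r)) i j l m := by
  have hrotate : ∀ {i j l m : DCVertex k},
      (doubleCircleSystem k).Ccw i j l m ↔ (doubleCircleSystem k).Ccw i l m j := by
    intro i j l m
    simp only [doubleCircleSystem_ccw, CyclicLT]
    tauto
  rcases i with _ | x <;> rcases j with _ | a <;> rcases l with _ | b <;> rcases m with _ | c <;>
    simp only [ne_eq, Option.some.injEq, not_true_eq_false, reduceCtorEq, not_false_eq_true] at *
  · exact chain_ccw_u r hjl hlm hjm
  · rw [hrotate, CcwAround.rotate_iff]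
    exact chain_ccw_u_right hk hi hl hm (Ne.symm hli) (Ne.symm hmi) hlm
  · rw [← hrotate, ← CcwAround.rotate_iff]
    exact chain_ccw_u_right hk hi hm hj (Ne.symm hmi) (Ne.symm hji) (Ne.symm hjm)
  · exact chain_ccw_u_right hk hi hj hl (Ne.symm hji) (Ne.symm hli) hjl
  · simp only [doubleCircleSystem_ccw_some, ne_eq, hji, hli, hmi, not_false_eq_true, true_and]
    exact (isOrientedAsDoubleCircle_chain hk r).cyclicLT_iff_ccwAround hk hi hj hl hm
      (Ne.symm hji) (Ne.symm hli) (Ne.symm hmi) hjl hlm hjm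

theorem pointChirotope_chain_ne_zero (hk : 3 ≤ k) {r : Fin k ⊕ Fin k} {a b c : DCVertex k}
    (ha : a ≠ some r) (hb : b ≠ some r) (hc : c ≠ some r) (hab : a ≠ b) (hbc : b ≠ c)
    (hac : a ≠ c) : pointChirotope (chain r) a b c ≠ 0 := by
  rcases a with _ | a <;> rcases b with _ | b <;> rcases c with _ | c <;>
    simp only [ne_eq, Option.some.injEq, not_true_eq_false, reduceCtorEq, not_false_eq_true] at *
  · exact (pointChirotope_chain_u hbc).2
  · rw [← pointChirotope_rotate]
    exact (pointChirotope_chain_u (Ne.symm hac)).2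
  · rw [pointChirotope_rotate]
    exact (pointChirotope_chain_u hab).2
  · exact (isOrientedAsDoubleCircle_chain hk r a ha b hb c hc hab hbc hac).2

end DCVertex

theorem doubleCircleSystem_induce_compl_singleton_realizableAsPointSet {k : ℕ}
    (hk : 3 ≤ k) (r : Fin k ⊕ Fin k) :
    ((doubleCircleSystem k).induce {some r}ᶜ).RealizableAsPointSet := by
  have hcard : 3 ≤ Cardinal.mk ({some r}ᶜ : Set (DCVertex k)) := by
    rw [Cardinal.mk_fintype, Fintype.card_compl_set, Fintype.card_option, Fintype.card_sum,
      Fintype.card_fin, Set.card_singleton]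
    exact_mod_cast (by omega : 3 ≤ k + k + 1 - 1)
  refine ⟨fun x => chain r x, .of_pointChirotope_ne_zero hcard fun a b c hab hbc hac => ?_,
    fun i j l m hj hl hm hjl hlm hjm => ?_⟩
  · exact pointChirotope_chain_ne_zero hk a.2 b.2 c.2 (Subtype.val_injective.ne hab)
      (Subtype.val_injective.ne hbc) (Subtype.val_injective.ne hac)
  · rw [RadialSystem.induce, RadialSystem.comap_ccw]
    exact chain_ccw hk i.2 j.2 l.2 m.2 (Subtype.val_injective.ne hj) (Subtype.val_injective.ne hl)
      (Subtype.val_injective.ne hm) (Subtype.val_injective.ne hjl) (Subtype.val_injective.ne hlm)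
      (Subtype.val_injective.ne hjm)

theorem doubleCircleSystem_induce_realizableAsPointSet {k : ℕ} (hk : 3 ≤ k) {S : Set (DCVertex k)}
    (hS : S ≠ Set.univ) : ((doubleCircleSystem k).induce S).RealizableAsPointSet := by
  obtain ⟨_ | r, hr⟩ := (Set.ne_univ_iff_exists_notMem S).1 hS
  · obtain ⟨ε, hε⟩ := (eventually_isRealizedByPoints_doubleCircle hk).exists
    refine RadialSystem.RealizableAsPointSet.induce_of_subset_range ⟨_, hε⟩ fun x hx => ?_
    obtain ⟨y, rfl⟩ := Option.ne_none_iff_exists.1 (ne_of_mem_of_not_mem hx hr)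
    exact ⟨y, rfl⟩
  · have hcompl := doubleCircleSystem_induce_compl_singleton_realizableAsPointSet hk r
    exact hcompl.induce_of_subset_range fun x hx => ⟨⟨x, ne_of_mem_of_not_mem hx hr⟩, rfl⟩

/-! ### Pseudo-lines from straight lines -/

/-- No two of the points are on a vertical line and no two of their connecting lines are parallel,
so that these lines are the pseudo-lines of a generalized configuration. -/
structure IsTransversal {V : Type*} (p : V → ℝ × ℝ) : Prop where
  fst_ne : ∀ a b, a ≠ b → (p b).1 - (p a).1 ≠ 0
  not_parallel : ∀ a b c d, a ≠ b → c ≠ d → s(a, b) ≠ s(c, d) →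
    ((p b).1 - (p a).1) * ((p d).2 - (p c).2) - ((p b).2 - (p a).2) * ((p d).1 - (p c).1) ≠ 0

theorem eventually_cofinite_quadratic_ne_zero {c₀ c₁ c₂ : ℝ} (h : c₁ ≠ 0 ∨ c₂ ≠ 0) :
    ∀ᶠ ε in cofinite, c₂ * ε ^ 2 + c₁ * ε + c₀ ≠ 0 := by
  open Polynomial in
  have hP : C c₂ * X ^ 2 + C c₁ * X + C c₀ ≠ 0 := fun hP => by
    rcases h with h | h
    · exact h (by simpa [coeff_X, coeff_C] using congrArg (coeff · 1) hP)
    · exact h (by simpa [coeff_X, coeff_C] using congrArg (coeff · 2) hP)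
  filter_upwards [(Polynomial.finite_setOfPred_isRoot hP).compl_mem_cofinite] with ε hε
  simpa [Polynomial.IsRoot] using hε

section Perturbation

variable {V : Type*}

/-- Chords of a parabola have the sum of the end points' abscissas as their slope, and the sums of
two distinct powers of `2` are distinct. -/
theorem isTransversal_parabola_two_pow {n : V → ℕ} (hn : Function.Injective n) :
    IsTransversal fun a => ((2 : ℝ) ^ n a, ((2 : ℝ) ^ n a) ^ 2) := by
  have fst_ne : ∀ a b, a ≠ b → (2 : ℝ) ^ n b - 2 ^ n a ≠ 0 := fun a b hab =>
    sub_ne_zero.2 fun h => hab (hn (Nat.pow_right_injective le_rfl (mod_cast h.symm)))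
  refine ⟨fst_ne, fun a b c d hab hcd hne h => hne ?_⟩
  have hslope : (2 : ℝ) ^ n a + 2 ^ n b = 2 ^ n c + 2 ^ n d :=
    mul_left_cancel₀ (mul_ne_zero (fst_ne a b hab) (fst_ne c d hcd)) (by linear_combination -h)
  have hpair : ({n a, n b} : Finset ℕ) = {n c, n d} := by
    refine Finset.geomSum_injective (n := 2) le_rfl ?_
    beta_reduce
    rw [Finset.sum_pair (hn.ne hab), Finset.sum_pair (hn.ne hcd)]
    exact mod_cast hslope
  have hpair_coe := congrArg ((↑) : Finset ℕ → Set ℕ) hpair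
  rw [Finset.coe_pair, Finset.coe_pair, Set.pair_eq_pair_iff] at hpair_coe
  simpa only [Sym2.eq_iff, hn.eq_iff] using hpair_coe

variable [Finite V]

theorem IsTransversal.eventually_add_smul {q : V → ℝ × ℝ} (hq : IsTransversal q)
    (p : V → ℝ × ℝ) : ∀ᶠ ε : ℝ in cofinite, IsTransversal (p + ε • q) := by
  have hfst : ∀ᶠ ε : ℝ in cofinite, ∀ a b, a ≠ b → ((p + ε • q) b).1 - ((p + ε • q) a).1 ≠ 0 := by
    simp only [eventually_all]
    intro a b hab
    filter_upwards [eventually_cofinite_quadratic_ne_zero (c₀ := (p b).1 - (p a).1) (c₂ := 0)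
      (Or.inl (hq.fst_ne a b hab))] with ε hε
    convert hε using 1
    simp only [Pi.add_apply, Pi.smul_apply, Prod.fst_add, Prod.smul_fst, smul_eq_mul]
    ring
  have hparallel : ∀ᶠ ε : ℝ in cofinite, ∀ a b c d, a ≠ b → c ≠ d → s(a, b) ≠ s(c, d) →
      (((p + ε • q) b).1 - ((p + ε • q) a).1) * (((p + ε • q) d).2 - ((p + ε • q) c).2) -
        (((p + ε • q) b).2 - ((p + ε • q) a).2) *
          (((p + ε • q) d).1 - ((p + ε • q) c).1) ≠ 0 := by
    simp only [eventually_all]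
    intro a b c d hab hcd hne
    filter_upwards [eventually_cofinite_quadratic_ne_zero
      (c₀ := ((p b).1 - (p a).1) * ((p d).2 - (p c).2) -
        ((p b).2 - (p a).2) * ((p d).1 - (p c).1))
      (c₁ := ((p b).1 - (p a).1) * ((q d).2 - (q c).2) +
        ((q b).1 - (q a).1) * ((p d).2 - (p c).2) -
        (((p b).2 - (p a).2) * ((q d).1 - (q c).1) +
          ((q b).2 - (q a).2) * ((p d).1 - (p c).1)))
      (Or.inr (hq.not_parallel a b c d hab hcd hne))] with ε hε
    convert hε using 1
    simp only [Pi.add_apply, Pi.smul_apply, Prod.fst_add, Prod.snd_add, Prod.smul_fst,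
      Prod.smul_snd, smul_eq_mul]
    ring
  filter_upwards [hfst, hparallel] with ε h₁ h₂ using ⟨h₁, h₂⟩

theorem GeneralPosition.eventually_pointChirotope_add_smul {p : V → ℝ × ℝ}
    (hp : GeneralPosition p) (q : V → ℝ × ℝ) :
    ∀ᶠ ε : ℝ in 𝓝 0, ∀ a b c, a ≠ b → b ≠ c → a ≠ c →
      pointChirotope (p + ε • q) a b c = pointChirotope p a b c := by
  simp only [eventually_all]
  intro a b c hab hbc hac
  have h₀ : p + (0 : ℝ) • q = p := by rw [zero_smul, add_zero]
  have hcont : ContinuousAt (fun ε : ℝ => pointChirotope (p + ε • q) a b c) 0 := by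
    refine (continuousAt_sign_of_ne_zero ?_).comp (f := fun ε : ℝ =>
      (((p + ε • q) b).1 - ((p + ε • q) a).1) * (((p + ε • q) c).2 - ((p + ε • q) a).2) -
        (((p + ε • q) b).2 - ((p + ε • q) a).2) * (((p + ε • q) c).1 - ((p + ε • q) a).1)) ?_
    · rw [h₀]
      exact sign_ne_zero.1 (hp.2 a b c hab hbc hac)
    · simp only [Pi.add_apply, Pi.smul_apply]
      fun_prop
  simpa only [h₀, Set.mem_singleton_iff] using
    hcont.eventually_mem (mem_nhds_discrete.2 (Set.mem_singleton _))

theorem GeneralPosition.exists_isTransversal {p : V → ℝ × ℝ} (hp : GeneralPosition p) :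
    ∃ p' : V → ℝ × ℝ, IsTransversal p' ∧ ∀ a b c, a ≠ b → b ≠ c → a ≠ c →
      pointChirotope p' a b c = pointChirotope p a b c := by
  obtain ⟨n, hn⟩ := exists_injective_nat V
  have htransversal := (isTransversal_parabola_two_pow hn).eventually_add_smul p
  have hχ := hp.eventually_pointChirotope_add_smul fun a => ((2 : ℝ) ^ n a, ((2 : ℝ) ^ n a) ^ 2)
  obtain ⟨ε, hε⟩ := ((htransversal.filter_mono (nhdsNE_le_cofinite 0)).and
    (hχ.filter_mono nhdsWithin_le_nhds)).exists
  exact ⟨_, hε⟩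

end Perturbation

theorem crossOnce_of_slope_ne {m₁ m₂ : ℝ} (h : m₁ ≠ m₂) (c₁ c₂ : ℝ) :
    CrossOnce (fun x => m₁ * x + c₁) (fun x => m₂ * x + c₂) := by
  have hd : m₁ - m₂ ≠ 0 := sub_ne_zero.2 h
  obtain ⟨x₀, hx₀⟩ : ∃ x₀, (m₁ - m₂) * x₀ = c₂ - c₁ := ⟨(c₂ - c₁) / (m₁ - m₂), by field_simp⟩
  refine ⟨x₀, by linear_combination hx₀, ?_⟩
  rcases lt_or_gt_of_ne h with h | h
  · exact Or.inr ⟨fun x hx => by nlinarith, fun x hx => by nlinarith⟩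
  · exact Or.inl ⟨fun x hx => by nlinarith, fun x hx => by nlinarith⟩

/-- The slope-intercept form of the line through `p a` and `p b`. The intercept is computed at the
midpoint, which makes the formula symmetric also where `p a` and `p b` have the same abscissa and
the slope is a division by `0`. -/
noncomputable def connectingLine {V : Type*} (p : V → ℝ × ℝ) (a b : V) (x : ℝ) : ℝ :=
  ((p b).2 - (p a).2) / ((p b).1 - (p a).1) * x + (((p a).2 + (p b).2) / 2 -
    ((p b).2 - (p a).2) / ((p b).1 - (p a).1) * (((p a).1 + (p b).1) / 2))

theorem connectingLine_swap {V : Type*} (p : V → ℝ × ℝ) (a b : V) :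
    connectingLine p a b = connectingLine p b a := by
  funext x
  rw [connectingLine, connectingLine, ← neg_sub (p b).2 (p a).2, ← neg_sub (p b).1 (p a).1,
    neg_div_neg_eq]
  ring

namespace IsTransversal

variable {V : Type*} {p : V → ℝ × ℝ} {a b : V}

theorem sub_connectingLine (hp : IsTransversal p) (hab : a ≠ b) (c : V) :
    ((p b).1 - (p a).1) * ((p c).2 - connectingLine p a b (p c).1) =
      ((p b).1 - (p a).1) * ((p c).2 - (p a).2) - ((p b).2 - (p a).2) * ((p c).1 - (p a).1) := by
  have := hp.fst_ne a b hab
  rw [connectingLine]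
  field_simp
  ring

theorem eq_connectingLine_iff (hp : IsTransversal p) (hab : a ≠ b) (c : V) :
    (p c).2 = connectingLine p a b (p c).1 ↔ c = a ∨ c = b := by
  rw [← sub_eq_zero, ← mul_eq_zero_iff_left (hp.fst_ne a b hab), hp.sub_connectingLine hab]
  constructor
  · intro h
    by_contra! hc
    refine hp.not_parallel a b a c hab hc.1.symm (fun he => hc.2 ?_) h
    exact (Sym2.congr_right.1 he).symm
  · rintro (rfl | rfl) <;> ring

end IsTransversal

namespace GeneralizedConfiguration

/-- The generalized configuration of a transversal point set and its straight connecting lines. -/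
noncomputable def ofPoints {V : Type*} (p : V → ℝ × ℝ) (hp : IsTransversal p) :
    GeneralizedConfiguration V where
  pt := p
  pt_injective a b h := by
    by_contra hab
    exact hp.fst_ne a b hab (by rw [h, sub_self])
  line := Sym2.lift ⟨connectingLine p, connectingLine_swap p⟩
  continuous_line e _ := by
    induction e with | _ a b
    change Continuous fun x => connectingLine p a b x
    unfold connectingLine
    fun_prop
  mem_line_iff e he c := by
    induction e with | _ a b
    rw [Sym2.lift_mk, Sym2.mem_iff]
    exact hp.eq_connectingLine_iff (by simpa using he) c
  crossOnce e f he hf hef := by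
    induction e with | _ a b
    induction f with | _ c d
    have hab : a ≠ b := by simpa using he
    have hcd : c ≠ d := by simpa using hf
    refine crossOnce_of_slope_ne (fun h => hp.not_parallel a b c d hab hcd hef ?_) _ _
    rw [div_eq_div_iff (hp.fst_ne a b hab) (hp.fst_ne c d hcd)] at h
    linear_combination -h

theorem chirotope_ofPoints {V : Type*} {p : V → ℝ × ℝ} (hp : IsTransversal p) {a b : V}
    (hab : a ≠ b) (c : V) : (ofPoints p hp).chirotope a b c = pointChirotope p a b c :=
  congrArg SignType.sign (hp.sub_connectingLine hab c)

end GeneralizedConfiguration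

theorem RadialSystem.RealizableAsPointSet.realizableAsAbstractOrderType {V : Type*} [Finite V]
    {R : RadialSystem V} (h : R.RealizableAsPointSet) : R.RealizableAsAbstractOrderType := by
  obtain ⟨p, hp, hR⟩ := h
  obtain ⟨p', hp', hχ⟩ := hp.exists_isTransversal
  refine ⟨.ofPoints p' hp', fun i j l m hj hl hm hjl hlm hjm => ?_⟩
  rw [hR i j l m hj hl hm hjl hlm hjm, CcwAround, CcwAround]
  simp only [GeneralizedConfiguration.chirotope_ofPoints hp', hj.symm, hl.symm, hm.symm, ne_eq,
    not_false_eq_true, hχ i j l hj.symm hjl hl.symm, hχ i l m hl.symm hlm hm.symm,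
    hχ i m j hm.symm hjm.symm hj.symm]

theorem DCVertex.card (k : ℕ) : Fintype.card (DCVertex k) = 2 * k + 1 := by
  simp [DCVertex, two_mul]

theorem mainTheorem3 :
    (∀ k : ℕ, 3 ≤ k →
      Fintype.card (DCVertex k) = 2 * k + 1 ∧
      ∃ R : RadialSystem (DCVertex k),
        IsDoubleCirclePlusVertex R ∧
        ¬ R.RealizableAsAbstractOrderType ∧
        ∀ S : Set (DCVertex k), S ≠ Set.univ → (R.induce S).RealizableAsPointSet) ∧
    ¬ ∃ m : ℕ, ∀ (V : Type) [Finite V] (R : RadialSystem V),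
        (∀ S : Set V, S.ncard ≤ m → (R.induce S).RealizableAsAbstractOrderType) →
          R.RealizableAsAbstractOrderType := by
  refine ⟨fun k hk => ⟨DCVertex.card k, doubleCircleSystem k,
    ⟨eventually_isRealizedByPoints_doubleCircle hk, doubleCircleSystem_directlyBetween_v hk,
      doubleCircleSystem_directlyBetween_w hk⟩,
    doubleCircleSystem_not_realizableAsAbstractOrderType hk,
    fun S hS => doubleCircleSystem_induce_realizableAsPointSet hk hS⟩, ?_⟩
  rintro ⟨m, hm⟩
  have hk : 3 ≤ m + 3 := by omega
  refine doubleCircleSystem_not_realizableAsAbstractOrderType hk (hm _ _ fun S hS => ?_)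
  refine (doubleCircleSystem_induce_realizableAsPointSet hk ?_).realizableAsAbstractOrderType
  rintro rfl
  rw [Set.ncard_univ, Nat.card_eq_fintype_card, DCVertex.card] at hS
  omega
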